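/- **Conventions.** For a finite set $Q$ of qubits let $\mathbf L(Q)$ be the space of linear operators on $(\mathbb C^2)^{\otimes Q}$. A superoperator is a linear map between such spaces, and a channel is a completely positive trace-preserving superoperator. The diamond norm of a superoperator $\mathcal T$ is $\|\mathcal T\|_\diamond=\sup_G\sup_{\|\rho\|_1\le 1}\|(\mathcal I_G\otimes\mathcal T)(\rho)\|_1$, where $G$ ranges over finite-dimensional reference systems and $\|\cdot\|_1$ is the trace norm. For real $z$, an operator on $Q$ has weight $z$ if it is a linear combination of operators each of which acts nontrivially only on some set of at most $z$ qubits. A superoperator has weight $z$ if it is a linear combination of maps $\rho\mapsto E_1\rho E_2^\dagger$ with $E_1,E_2$ of weight $z$. **Syndrome extraction circuits.** Let $l<n$, and consider $n$ data qubits and $l$ ancilla qubits. Let $\Phi$ be a circuit of depth $d\ge 2$ of the following form (the form of a syndrome extraction circuit of a quantum code with $n$ physical qubits and $l$ generators). - Its input is the $n$ data qubits. In layer $1$ each ancilla qubit is initialized in $|0\rangle$ or $|+\rangle$. - In each of the layers $2,\dots,d-1$ the $n+l$ qubits are partitioned into locations. Each location consists of a single qubit or of one data qubit and one ancilla qubit,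 and a unitary gate (such as the idle gate, CNOT or CZ) is applied at each location. - In layer $d$ each ancilla qubit is measured in the Pauli-$Z$ or Pauli-$X$ basis, with a classical bit as output. - In layers $1$ and $d$ an idle gate acts on each data qubit. Let $\mathcal T_i=\bigotimes_j\mathcal T_{ij}$ be the channel of layer $i$, where $\mathcal T_{ij}$ is the channel of location $j$ (idle gates are locations too), and let $\mathcal T_{[d-1]}=\mathcal T_{d-1}\circ\cdots\circ\mathcal T_1$. For $\delta\in[0,1]$ let $\mathbb T\mathrm{rans}(\Phi,\delta)$ be the set of all channels $\tilde{\mathcal T}_d\circ\cdots\circ\tilde{\mathcal T}_1$ with $\tilde{\mathcal T}_i=\bigotimes_j\tilde{\mathcal T}_{ij}$, where each $\tilde{\mathcal T}_{ij}$ is an arbitrary channel with the same input and output spaces as $\mathcal T_{ij}$ (so a noisy measurement still outputs a classical bit) and $\|\tilde{\mathcal T}_{ij}-\mathcal T_{ij}\|_\diamond\le\delta$. **Lemma.** Suppose that $\exp(-n\delta/3)\le \frac1{ed}$. Then for every $\tilde{\mathcal T}_\Phi\in\mathbb T\mathrm{rans}(\Phi,\delta)$ there is a superoperator $\overline{\mathcal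 T}_\Phi$ such that $$\|\tilde{\mathcal T}_\Phi-\overline{\mathcal T}_\Phi\|_\diamond< e\,d\,\exp\!\left(-\frac{n\delta}{3}\right)\qquad\text{and}\qquad \overline{\mathcal T}_\Phi=\mathcal T_d\circ\mathcal N\circ\mathcal T_{[d-1]},$$ where $\mathcal N$ is a superoperator on the $n+l$ qubits of weight $5n\delta\,2^{d+1}$. -/

import Mathlib

open scoped Matrix ENNReal ComplexOrder

noncomputable section

/-! ### Operators, trace norm, superoperators, diamond norm -/

/-- Linear operators on the Hilbert space of a finite set `Q` of qubits, written as matrices in the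
computational basis, which is indexed by the bit strings `Q → Bool`. -/
abbrev Op (Q : Type) : Type := Matrix (Q → Bool) (Q → Bool) ℂ

/-- The trace norm `‖A‖₁ = tr √(Aᴴ A)`, i.e. the sum of the singular values of `A`. -/
def traceNorm {α : Type} [Fintype α] [DecidableEq α] (A : Matrix α α ℂ) : ℝ :=
  ∑ i, Real.sqrt ((Matrix.isHermitian_conjTranspose_mul_self A).eigenvalues i)

/-- The superoperator `𝓘_G ⊗ T`, where `G` is a `k`-dimensional reference system. It applies `T` to
each of the `k × k` blocks of its argument. -/
def ampliate (k : ℕ) {α β : Type} (T : Matrix α α ℂ →ₗ[ℂ] Matrix β β ℂ) :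
    Matrix (Fin k × α) (Fin k × α) ℂ →ₗ[ℂ] Matrix (Fin k × β) (Fin k × β) ℂ where
  toFun ρ := Matrix.of fun x y => T (ρ.submatrix (Prod.mk x.1) (Prod.mk y.1)) x.2 y.2
  map_add' ρ σ := by
    ext x y
    simp [Matrix.submatrix_add]
  map_smul' c ρ := by
    ext x y
    simp [Matrix.submatrix_smul]

/-- The diamond norm: the supremum over all finite-dimensional reference systems `G` and all
operators `ρ` with `‖ρ‖₁ ≤ 1` of `‖(𝓘_G ⊗ T) ρ‖₁`. It is taken in `[0, ∞]`. -/
def diamondNorm {α β : Type} [Fintype α] [DecidableEq α] [Fintype β] [DecidableEq β]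
    (T : Matrix α α ℂ →ₗ[ℂ] Matrix β β ℂ) : ℝ≥0∞ :=
  ⨆ (k : ℕ) (ρ : Matrix (Fin k × α) (Fin k × α) ℂ) (_ : traceNorm ρ ≤ 1),
    ENNReal.ofReal (traceNorm (ampliate k T ρ))

/-- Quantum channels: completely positive trace-preserving superoperators. -/
structure IsChannel {α β : Type} [Fintype α] [Fintype β]
    (T : Matrix α α ℂ →ₗ[ℂ] Matrix β β ℂ) : Prop where
  completely_positive : ∀ (k : ℕ) (ρ : Matrix (Fin k × α) (Fin k × α) ℂ),
    ρ.PosSemidef → (ampliate k T ρ).PosSemidef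
  trace_preserving : ∀ ρ : Matrix α α ℂ, (T ρ).trace = ρ.trace

/-- A `δ`-noisy version of a gate `T`: an arbitrary channel with the same input and output spaces
that is `δ`-close to `T` in diamond norm. -/
def IsNoisyVersion {α β : Type} [Fintype α] [DecidableEq α] [Fintype β] [DecidableEq β]
    (δ : ℝ) (T T' : Matrix α α ℂ →ₗ[ℂ] Matrix β β ℂ) : Prop :=
  IsChannel T' ∧ diamondNorm (T' - T) ≤ ENNReal.ofReal δ

/-- The superoperator `ρ ↦ E₁ ρ E₂`. -/
def sandwich {α : Type} [Fintype α] (E₁ E₂ : Matrix α α ℂ) :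
    Matrix α α ℂ →ₗ[ℂ] Matrix α α ℂ where
  toFun ρ := E₁ * ρ * E₂
  map_add' ρ σ := by rw [Matrix.mul_add, Matrix.add_mul]
  map_smul' c ρ := by simp

/-! ### Weight of operators and superoperators -/

section Weight

variable {Q : Type} [Fintype Q] [DecidableEq Q]

/-- The operator `(⊗_{q ∉ A} 𝟙) ⊗ E` on all the qubits, for an operator `E` on the qubits in `A`. -/
def extendOp (A : Finset Q) (E : Op {q // q ∈ A}) : Op Q :=
  Matrix.of fun x y =>
    if ∀ q, q ∉ A → x q = y q then E (fun q => x q) (fun q => y q) else 0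

/-- The space `𝓔(Q, z)` of operators of weight `z`: the span of the operators that act only on some
set of at most `z` qubits. -/
def operatorsOfWeight (Q : Type) [Fintype Q] [DecidableEq Q] (z : ℝ) : Submodule ℂ (Op Q) :=
  Submodule.span ℂ
    {X | ∃ A : Finset Q, (A.card : ℝ) ≤ z ∧ ∃ E : Op {q // q ∈ A}, X = extendOp A E}

/-- The space `𝓔(Q, z) (·) 𝓔(Q, z)*` of superoperators of weight `z`: the span of the maps
`ρ ↦ E₁ ρ E₂ᴴ` with `E₁` and `E₂` of weight `z`. -/
def superoperatorsOfWeight (Q : Type) [Fintype Q] [DecidableEq Q] (z : ℝ) :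
    Submodule ℂ (Op Q →ₗ[ℂ] Op Q) :=
  Submodule.span ℂ
    {T | ∃ E₁ ∈ operatorsOfWeight Q z, ∃ E₂ ∈ operatorsOfWeight Q z, T = sandwich E₁ E₂ᴴ}

end Weight

/-! ### One layer of a circuit -/

/-- The register of a location `j`: the wires that a partition of the wires `W` into registers,
given by the map `f` that sends each wire to its location, assigns to `j`. -/
abbrev Register {W J : Type} (f : W → J) (j : J) : Type := {w : W // f w = j}

/-- The tensor product `⊗_j T_j` of the gates of one layer. Location `j` acts on the input wires
`w` with `f w = j`, and its output is stored in the output wires `v` with `g v = j`. The definition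
gives the matrix entries of the image of `ρ = ∑ a a', ρ a a' |a⟩⟨a'|`, using that
`|a⟩⟨a'| = ⊗_j |a_j⟩⟨a'_j|` with `a_j` the restriction of `a` to the register of `j`. -/
def tensorGates {W V J : Type} [Fintype W] [DecidableEq W] [Fintype V] [Fintype J] [DecidableEq J]
    (f : W → J) (g : V → J) (T : ∀ j, Op (Register f j) →ₗ[ℂ] Op (Register g j)) :
    Op W →ₗ[ℂ] Op V where
  toFun ρ := Matrix.of fun b b' => ∑ a : W → Bool, ∑ a' : W → Bool, ρ a a' *
    ∏ j, T j (Matrix.single (fun w => a w.1) (fun w => a' w.1) 1)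
      (fun v => b v.1) (fun v => b' v.1)
  map_add' ρ σ := by
    ext b b'
    simp [add_mul, Finset.sum_add_distrib]
  map_smul' c ρ := by
    ext b b'
    simp [Finset.mul_sum, mul_assoc]

/-! ### Single-qubit preparations and measurements -/

/-- The Pauli bases in which ancilla qubits are initialized and measured. -/
inductive PauliBasis : Type
  | Z
  | X

/-- The amplitude `⟨x|v_s⟩` of the basis vectors `v_0, v_1` of a Pauli basis: `|0⟩, |1⟩` for `Z` and
`|+⟩, |-⟩` for `X`. -/
def PauliBasis.amplitude : PauliBasis → Bool → Bool → ℂ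
  | .Z, s, x => if s = x then 1 else 0
  | .X, s, x => ((Real.sqrt 2)⁻¹ : ℝ) * (if s && x then -1 else 1)

/-- The vector `⊗_r v_{s r}` of the Pauli basis. -/
def PauliBasis.ket {R : Type} [Fintype R] (B : PauliBasis) (s : R → Bool) : (R → Bool) → ℂ :=
  fun x => ∏ r, B.amplitude (s r) (x r)

/-- Preparation of `|0⟩` (basis `Z`) or `|+⟩` (basis `X`) on each qubit of the output register `R`;
the input register `R'` is discarded (it is empty where this is used). -/
def PauliBasis.prepare (B : PauliBasis) (R' R : Type) [Fintype R'] [DecidableEq R'] [Fintype R] :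
    Op R' →ₗ[ℂ] Op R where
  toFun ρ := ρ.trace •
    Matrix.vecMulVec (B.ket fun _ : R => false) (star (B.ket fun _ : R => false))
  map_add' ρ σ := by rw [Matrix.trace_add, add_smul]
  map_smul' c ρ := by rw [Matrix.trace_smul, RingHom.id_apply, smul_assoc]

/-- Measurement of each qubit of `R` in a Pauli basis, `ρ ↦ ∑ s, ⟨v_s|ρ|v_s⟩ |s⟩⟨s|`. The outcome is
a classical bit string; as usual, operators on classical bits are the diagonal matrices. -/
def PauliBasis.measure (B : PauliBasis) (R : Type) [Fintype R] [DecidableEq R] :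
    Op R →ₗ[ℂ] Op R where
  toFun ρ := Matrix.diagonal fun s => star (B.ket s) ⬝ᵥ (ρ *ᵥ B.ket s)
  map_add' ρ σ := by
    rw [Matrix.diagonal_add]
    congr 1
    funext s
    rw [Matrix.add_mulVec, dotProduct_add]
  map_smul' c ρ := by
    rw [RingHom.id_apply, ← Matrix.diagonal_smul]
    congr 1
    funext s
    rw [Matrix.smul_mulVec, dotProduct_smul, Pi.smul_apply]

/-! ### Syndrome extraction circuits -/

/-- The `n` data qubits and the `l` ancilla qubits. -/
abbrev Qubits (n l : ℕ) : Type := Fin n ⊕ Fin l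

/-- A layer of unitary gates. The qubits are partitioned into the registers of the locations. Each
location acts either on one qubit, where a waiting qubit has the identity as its gate, or on one
data qubit and one ancilla qubit (such as a CNOT or CZ gate). -/
structure EntanglingLayer (n l : ℕ) where
  /-- the number of locations -/
  size : ℕ
  /-- the location at which a qubit takes part -/
  loc : Qubits n l → Fin size
  loc_surjective : Function.Surjective loc
  data_injective : Function.Injective fun i : Fin n => loc (Sum.inl i)
  ancilla_injective : Function.Injective fun a : Fin l => loc (Sum.inr a)
  /-- the unitary that is applied at a location -/
  gate : ∀ j, Op (Register loc j)
  gate_unitary : ∀ j, gate j ∈ Matrix.unitaryGroup (Register loc j → Bool) ℂ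

/-- The channel `ρ ↦ U ρ Uᴴ` of a location of a layer of unitary gates. -/
def EntanglingLayer.gateChannel {n l : ℕ} (L : EntanglingLayer n l) (j : Fin L.size) :
    Op (Register L.loc j) →ₗ[ℂ] Op (Register L.loc j) :=
  sandwich (L.gate j) (L.gate j)ᴴ

/-- A circuit of the form of a syndrome extraction circuit, with `n` data qubits and `l` ancilla
qubits: a layer in which the ancilla qubits are initialized, then layers of unitary gates
that entangle data and ancilla qubits, then a layer in which the ancilla qubits are measured. The
data qubits are idle in the first and the last layer. -/
structure SyndromeCircuit (n l : ℕ) where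
  /-- the number of layers of unitary gates -/
  numEntangling : ℕ
  prepBasis : Fin l → PauliBasis
  layer : Fin numEntangling → EntanglingLayer n l
  measBasis : Fin l → PauliBasis

namespace SyndromeCircuit

variable {n l : ℕ} (Φ : SyndromeCircuit n l)

/-- The depth `d` of the circuit, counting the first and the last layer. -/
def depth : ℕ := Φ.numEntangling + 2

/-- The gates of the first layer: an idle gate on each data qubit and the preparation of a state on
each ancilla qubit. The input wires are the data qubits only, so a preparation has an empty input
register. -/
def initGate : ∀ j : Qubits n l,
    Op (Register (Sum.inl : Fin n → Qubits n l) j) →ₗ[ℂ] Op (Register (id : Qubits n l → _) j)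
  | .inl i =>
    { toFun := fun ρ => ρ.submatrix (fun x _ => x ⟨Sum.inl i, rfl⟩) (fun x _ => x ⟨Sum.inl i, rfl⟩)
      map_add' := fun _ _ => rfl
      map_smul' := fun _ _ => rfl }
  | .inr a => (Φ.prepBasis a).prepare _ _

/-- The gates of the last layer: an idle gate on each data qubit and a measurement of each ancilla
qubit. -/
def measGate : ∀ j : Qubits n l,
    Op (Register (id : Qubits n l → _) j) →ₗ[ℂ] Op (Register (id : Qubits n l → _) j)
  | .inl _ => LinearMap.id
  | .inr a => (Φ.measBasis a).measure _

/-- The composition `F_{m-1} ∘ ⋯ ∘ F_0`. -/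
def composeLayers {M : Type} [AddCommMonoid M] [Module ℂ M] :
    (m : ℕ) → (Fin m → (M →ₗ[ℂ] M)) → (M →ₗ[ℂ] M)
  | 0, _ => LinearMap.id
  | m + 1, F => F (Fin.last m) ∘ₗ composeLayers m fun i => F i.castSucc

/-- The channel `T_{[d-1]} = T_{d-1} ∘ ⋯ ∘ T_1` of all the layers but the last one. -/
def channelBeforeMeasurement : Op (Fin n) →ₗ[ℂ] Op (Qubits n l) :=
  composeLayers Φ.numEntangling
      (fun i => tensorGates (Φ.layer i).loc (Φ.layer i).loc (Φ.layer i).gateChannel) ∘ₗ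
    tensorGates Sum.inl id Φ.initGate

/-- The channel `T_d` of the last layer. -/
def measurementChannel : Op (Qubits n l) →ₗ[ℂ] Op (Qubits n l) :=
  tensorGates id id Φ.measGate

/-- The set `𝕋rans(Φ, δ)` of the channels that are realized by the circuit under general circuit
noise with error rate `δ`: at each location, idle locations included, the gate is replaced
by an arbitrary `δ`-noisy version of it. The output of a noisy measurement remains classical. -/
def noisyRealizations (δ : ℝ) : Set (Op (Fin n) →ₗ[ℂ] Op (Qubits n l)) :=
  {T | ∃ (init : ∀ j : Qubits n l, Op (Register (Sum.inl : Fin n → Qubits n l) j) →ₗ[ℂ]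
          Op (Register (id : Qubits n l → _) j))
        (mid : ∀ (i : Fin Φ.numEntangling) (j : Fin (Φ.layer i).size),
          Op (Register (Φ.layer i).loc j) →ₗ[ℂ] Op (Register (Φ.layer i).loc j))
        (meas : ∀ j : Qubits n l, Op (Register (id : Qubits n l → _) j) →ₗ[ℂ]
          Op (Register (id : Qubits n l → _) j)),
      (∀ j, IsNoisyVersion δ (Φ.initGate j) (init j)) ∧
      (∀ i j, IsNoisyVersion δ ((Φ.layer i).gateChannel j) (mid i j)) ∧
      (∀ j, IsNoisyVersion δ (Φ.measGate j) (meas j)) ∧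
      (∀ (a : Fin l) ρ, (meas (Sum.inr a) ρ).IsDiag) ∧
      T = tensorGates id id meas ∘ₗ
        composeLayers Φ.numEntangling
          (fun i => tensorGates (Φ.layer i).loc (Φ.layer i).loc (mid i)) ∘ₗ
        tensorGates Sum.inl id init}

end SyndromeCircuit

end

/-! In each layer write every noisy gate as `T j + D j` with `D j` of diamond norm at most `δ`, and
expand the tensor product over the set `A` of locations that contribute `D j` (`tensorGates_add`). A
term has diamond norm at most `δ ^ |A|`. With `μ = nδ` and at most `n + l ≤ 2n` locations, a
Chernoff estimate (`sum_pow_card_le`) shows that the terms with `|A| > 10μ` contribute at most `x =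
exp(-μ/3)`. Dropping them leaves errors on few locations only (`diamondBound_sub_truncatedLayer`).

The truncated layer must then be written as a low-weight superoperator next to the ideal layer.
Preparations and unitary gates have left inverses, so there `D j = N j ∘ T j` and the error follows
the ideal layer. A measurement is not injective, but it hits every diagonal matrix, and noisy
outcomes are still classical, so there `D j = T j ∘ N j` and the error precedes the ideal layer
(`exists_eq_measGate_comp`). The weight is at most `10μ` in the two outer layers and `20μ` in the
unitary ones, whose locations hold at most two qubits.

The errors are finally pushed past the later unitary layers. Conjugation by such a layer at most
doubles the weight (`exists_comm_tensorGates`), and weights add under composition. After `m` unitary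
layers this gives `10μ(3·2^m - 2)`, to which the measurement adds `10μ`. Replacing the layers one at
a time costs `(1 + x)^d - 1` in diamond norm (`exists_approx_composeLayers`), which is below `e d x`
because `d x < 1`.

The diamond norm facts rest on a semidefinite description: `2‖A‖₁` is the least `tr P + tr Q` over
positive semidefinite blocks `[P, A; Aᴴ, Q]`. The triangle inequality and the contractivity of
channels follow by acting on the blocks. -/

/-! ### The trace norm as a semidefinite optimum -/

open Matrix in
/-- The singular value decomposition `A = V D Uᴴ` with `U` unitary, `V` a partial isometry and `D`
the diagonal matrix of the singular values. -/
theorem exists_svd {α : Type} [Fintype α] [DecidableEq α] (A : Matrix α α ℂ) :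
    ∃ (V U : Matrix α α ℂ) (σ : α → ℝ), (∀ i, 0 ≤ σ i) ∧ U * Uᴴ = 1 ∧ Uᴴ * U = 1 ∧
      A = V * diagonal (fun i => (σ i : ℂ)) * Uᴴ ∧ V * Vᴴ * V = V ∧
      Vᴴ * V * diagonal (fun i => (σ i : ℂ)) = diagonal (fun i => (σ i : ℂ)) ∧
      traceNorm A = ∑ i, σ i := by
  have h := isHermitian_conjTranspose_mul_self A
  obtain ⟨σ, hσ⟩ : ∃ σ : α → ℝ, σ = fun i => Real.sqrt (h.eigenvalues i) := ⟨_, rfl⟩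
  obtain ⟨U, hU⟩ : ∃ U : Matrix α α ℂ, U = h.eigenvectorUnitary := ⟨_, rfl⟩
  have hU1 : U * Uᴴ = 1 := by
    rw [hU]; exact Unitary.mul_star_self_of_mem h.eigenvectorUnitary.2
  have hU2 : Uᴴ * U = 1 := by
    rw [hU]; exact Unitary.star_mul_self_of_mem h.eigenvectorUnitary.2
  have hsq : ∀ i, ((σ i : ℂ)) ^ 2 = h.eigenvalues i := fun i => by
    rw [hσ, ← Complex.ofReal_pow,
      Real.sq_sqrt ((posSemidef_conjTranspose_mul_self A).eigenvalues_nonneg i)]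
  have hspec : Aᴴ * A = U * diagonal (fun i => (σ i : ℂ) ^ 2) * Uᴴ := by
    have := h.spectral_theorem
    rw [Unitary.conjStarAlgAut_apply] at this
    rw [this, hU]
    congr 3
    funext i
    simp [hsq]
  have hBB : (A * U)ᴴ * (A * U) = diagonal (fun i => (σ i : ℂ) ^ 2) := by
    rw [conjTranspose_mul, Matrix.mul_assoc, ← Matrix.mul_assoc Aᴴ, hspec]
    simp only [Matrix.mul_assoc, hU2, Matrix.mul_one]
    rw [← Matrix.mul_assoc, hU2, Matrix.one_mul]
  -- The isometry is `A U D⁻¹` with the convention `0⁻¹ = 0`, so its initial projection is the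
  -- indicator of the nonzero singular values.
  have hVV : ((A * U) * diagonal (fun i => ((σ i)⁻¹ : ℂ)))ᴴ *
      ((A * U) * diagonal (fun i => ((σ i)⁻¹ : ℂ))) =
      diagonal (fun i => if σ i = 0 then 0 else 1) := by
    rw [conjTranspose_mul, Matrix.mul_assoc, ← Matrix.mul_assoc _ (A * U), hBB,
      diagonal_conjTranspose, diagonal_mul_diagonal, diagonal_mul_diagonal]
    congr 1
    funext i
    by_cases h0 : σ i = 0
    · simp [h0]
    · have : (σ i : ℂ) ≠ 0 := by exact_mod_cast h0
      simp [h0]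
      field_simp
  refine ⟨(A * U) * diagonal (fun i => ((σ i)⁻¹ : ℂ)), U, σ, ?_, hU1, hU2, ?_, ?_, ?_, ?_⟩
  · intro i; rw [hσ]; exact Real.sqrt_nonneg _
  -- The columns of `A U` at vanishing singular values are zero, since the Gram matrix of the
  -- columns is `D²`; hence nothing is lost by inverting `D` only on its support.
  · have hz : (A * U) * diagonal (fun i => if σ i = 0 then (0 : ℂ) else 1) = A * U := by
      rw [← sub_eq_zero, ← conjTranspose_mul_self_eq_zero]
      have : A * U * diagonal (fun i => if σ i = 0 then (0 : ℂ) else 1) - A * U =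
          (A * U) * diagonal (fun i => if σ i = 0 then (-1 : ℂ) else 0) := by
        conv_lhs => rw [← Matrix.mul_one (A * U), Matrix.mul_assoc, Matrix.one_mul]
        rw [← Matrix.mul_sub, ← diagonal_one, diagonal_sub]
        congr 2
        funext i
        split_ifs <;> simp
      rw [this, conjTranspose_mul, Matrix.mul_assoc, ← Matrix.mul_assoc _ (A * U), hBB,
        diagonal_conjTranspose, diagonal_mul_diagonal, diagonal_mul_diagonal, ← diagonal_zero]
      congr 1
      funext i
      by_cases h0 : σ i = 0 <;> simp [h0]
    have : (diagonal (fun i => ((σ i)⁻¹ : ℂ)) * diagonal (fun i => (σ i : ℂ))) =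
        diagonal (fun i => if σ i = 0 then (0 : ℂ) else 1) := by
      rw [diagonal_mul_diagonal]
      congr 1
      funext i
      by_cases h0 : σ i = 0 <;> simp [h0]
    rw [Matrix.mul_assoc _ (diagonal _) (diagonal _), this, hz, Matrix.mul_assoc, hU1,
      Matrix.mul_one]
  · rw [Matrix.mul_assoc, hVV, Matrix.mul_assoc, diagonal_mul_diagonal]
    congr 2
    funext i
    by_cases h0 : σ i = 0 <;> simp [h0]
  · rw [hVV, diagonal_mul_diagonal]
    congr 1
    funext i
    by_cases h0 : σ i = 0 <;> simp [h0]
  · rw [hσ]; rfl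

theorem traceNorm_nonneg {α : Type} [Fintype α] [DecidableEq α] (A : Matrix α α ℂ) :
    0 ≤ traceNorm A :=
  Finset.sum_nonneg fun _ _ => Real.sqrt_nonneg _

-- The optimum is attained: with `A = V D Uᴴ`, the block matrix is `[V; U] D [V; U]ᴴ`.
open Matrix in
theorem exists_posSemidef_fromBlocks {α : Type} [Fintype α] [DecidableEq α]
    (A : Matrix α α ℂ) :
    ∃ P Q : Matrix α α ℂ, (fromBlocks P A Aᴴ Q).PosSemidef ∧
      P.trace = (traceNorm A : ℂ) ∧ Q.trace = (traceNorm A : ℂ) := by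
  obtain ⟨V, U, σ, hσ, hU1, hU2, hA, hV, hVD, htr⟩ := exists_svd A
  set D : Matrix α α ℂ := diagonal (fun i => (σ i : ℂ)) with hD
  have hDtr : D.trace = (traceNorm A : ℂ) := by
    rw [htr, hD, trace_diagonal]; push_cast; rfl
  have hDH : Dᴴ = D := by
    rw [hD, diagonal_conjTranspose]; congr 1; funext i; simp
  refine ⟨V * D * Vᴴ, U * D * Uᴴ, ?_, ?_, ?_⟩
  · have hDp : D.PosSemidef := PosSemidef.diagonal fun i => by simpa using hσ i
    have := hDp.mul_mul_conjTranspose_same (fromRows V U)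
    rwa [conjTranspose_fromRows_eq_fromCols_conjTranspose, fromRows_mul,
      fromRows_mul_fromCols, show V * D * Uᴴ = A from hA.symm,
      show U * D * Vᴴ = Aᴴ by rw [hA]; simp [hDH, Matrix.mul_assoc]] at this
  · rw [← hDtr, Matrix.mul_assoc, trace_mul_comm, Matrix.mul_assoc, trace_mul_comm, hVD]
  · rw [← hDtr, Matrix.mul_assoc, trace_mul_comm, Matrix.mul_assoc, hU2, Matrix.mul_one]

-- Compressing the block matrix by `[V; -U]` gives `tr(P V Vᴴ) + tr Q - 2 tr D ≥ 0`, and `V Vᴴ` is a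
-- projection, so `tr(P V Vᴴ) ≤ tr P`.
open Matrix in
theorem traceNorm_le_of_posSemidef {α : Type} [Fintype α] [DecidableEq α]
    {A C P Q : Matrix α α ℂ} (h : (fromBlocks P A C Q).PosSemidef) :
    2 * traceNorm A ≤ (P.trace + Q.trace).re := by
  obtain ⟨V, U, σ, hσ, hU1, hU2, hA, hV, hVD, htr⟩ := exists_svd A
  set D : Matrix α α ℂ := diagonal (fun i => (σ i : ℂ)) with hD
  have hDtr : D.trace = (traceNorm A : ℂ) := by
    rw [htr, hD, trace_diagonal]; push_cast; rfl
  have hDH : Dᴴ = D := by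
    rw [hD, diagonal_conjTranspose]; congr 1; funext i; simp
  have hC : C = Aᴴ := by
    have := h.isHermitian
    rw [isHermitian_fromBlocks_iff] at this
    exact this.2.1.symm
  have hP : P.PosSemidef := by
    have := h.submatrix (Sum.inl : α → α ⊕ α)
    rwa [show (fromBlocks P A C Q).submatrix Sum.inl Sum.inl = P from rfl] at this
  have h1 := (h.conjTranspose_mul_mul_same (fromRows V (-U))).trace_nonneg
  rw [conjTranspose_fromRows_eq_fromCols_conjTranspose, Matrix.mul_assoc,
    fromBlocks_mul_fromRows, fromCols_mul_fromRows, hC] at h1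
  have e1 : Vᴴ * (A * U) = D := by
    rw [hA, Matrix.mul_assoc, hU2, Matrix.mul_one, ← Matrix.mul_assoc, hVD]
  have e2 : Uᴴ * (Aᴴ * V) = D := by
    have := congrArg conjTranspose e1
    simpa [hDH, Matrix.mul_assoc] using this
  have e3 : (Uᴴ * (Q * U)).trace = Q.trace := by
    rw [trace_mul_comm, Matrix.mul_assoc, hU1, Matrix.mul_one]
  have e4 : (Vᴴ * (P * V)).trace = (P * (V * Vᴴ)).trace := by
    rw [trace_mul_comm, Matrix.mul_assoc]
  -- The compression of `P` to the complement of the range of `V` has nonnegative trace.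
  have h2 := (hP.conjTranspose_mul_mul_same (1 - V * Vᴴ)).trace_nonneg
  have hpi : (1 - V * Vᴴ) * (1 - V * Vᴴ)ᴴ = 1 - V * Vᴴ := by
    have : (V * Vᴴ) * (V * Vᴴ) = V * Vᴴ := by rw [← Matrix.mul_assoc, hV]
    simp [Matrix.sub_mul, Matrix.mul_sub, this]
  rw [trace_mul_comm, ← Matrix.mul_assoc, hpi, trace_mul_comm, Matrix.mul_sub, Matrix.mul_one,
    trace_sub] at h2
  have h1' : 0 ≤ (P * (V * Vᴴ)).trace - D.trace - D.trace + Q.trace := by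
    convert h1 using 1
    simp only [conjTranspose_neg, Matrix.mul_add, Matrix.neg_mul, Matrix.mul_neg, trace_add,
      trace_neg, e1, e2, e3, e4, neg_neg]
    ring
  have r1 := (Complex.le_def.1 h1').1
  have r2 := (Complex.le_def.1 h2).1
  simp [hDtr] at r1 r2
  simp only [Complex.add_re]
  linarith

open Matrix in
theorem traceNorm_add_le {α : Type} [Fintype α] [DecidableEq α] (A B : Matrix α α ℂ) :
    traceNorm (A + B) ≤ traceNorm A + traceNorm B := by
  obtain ⟨P, Q, h, hP, hQ⟩ := exists_posSemidef_fromBlocks A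
  obtain ⟨P', Q', h', hP', hQ'⟩ := exists_posSemidef_fromBlocks B
  have := h.add h'
  rw [fromBlocks_add] at this
  have := traceNorm_le_of_posSemidef this
  simp only [trace_add, hP, hQ, hP', hQ', Complex.add_re, Complex.ofReal_re] at this
  linarith

open Matrix in
theorem traceNorm_smul_le {α : Type} [Fintype α] [DecidableEq α] (c : ℂ) (A : Matrix α α ℂ) :
    traceNorm (c • A) ≤ ‖c‖ * traceNorm A := by
  by_cases hc : c = 0
  · subst hc
    have : (fromBlocks (0 : Matrix α α ℂ) (0 : Matrix α α ℂ) 0 0).PosSemidef := by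
      rw [fromBlocks_zero]; exact PosSemidef.zero
    have := traceNorm_le_of_posSemidef this
    simp only [trace_zero, add_zero, Complex.zero_re] at this
    simp only [zero_smul, norm_zero, zero_mul]
    linarith
  obtain ⟨P, Q, h, hP, hQ⟩ := exists_posSemidef_fromBlocks A
  have hn : (‖c‖ : ℂ) ≠ 0 := by simpa using hc
  -- Conjugating by `diag(c, ‖c‖)` and dividing by `‖c‖` turns the blocks `P, A, Q` into `‖c‖ P, c
  -- A, ‖c‖ Q`.
  have h1 := (h.mul_mul_conjTranspose_same
    (fromBlocks (c • (1 : Matrix α α ℂ)) 0 0 ((‖c‖ : ℂ) • (1 : Matrix α α ℂ)))).smul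
    (show (0 : ℝ) ≤ ‖c‖⁻¹ by positivity)
  rw [fromBlocks_conjTranspose, fromBlocks_multiply, fromBlocks_multiply, fromBlocks_smul] at h1
  have h2 := traceNorm_le_of_posSemidef h1
  have hcc : c * (starRingEnd ℂ) c = (‖c‖ : ℂ) * ‖c‖ := by
    rw [Complex.mul_conj, Complex.normSq_eq_norm_sq]; push_cast; ring
  have hreal : (‖c‖⁻¹ : ℝ) * (‖c‖ * ‖c‖) = ‖c‖ := by
    have : ‖c‖ ≠ 0 := by simpa using hc
    field_simp
  have hA : (‖c‖⁻¹ : ℝ) • (((c • (1 : Matrix α α ℂ)) * P + 0 * Aᴴ) * 0ᴴ +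
      ((c • (1 : Matrix α α ℂ)) * A + 0 * Q) * ((‖c‖ : ℂ) • (1 : Matrix α α ℂ))ᴴ) = c • A := by
    ext i j
    simp [conjTranspose_smul]
    field_simp
  rw [hA] at h2
  have ht : ∀ x : ℂ, ((‖c‖⁻¹ : ℝ) • (x * ((‖c‖ : ℂ) * ‖c‖))).re = ‖c‖ * x.re := by
    intro x
    rw [Complex.smul_re, mul_comm x, ← Complex.ofReal_mul, Complex.re_ofReal_mul, smul_eq_mul,
      ← mul_assoc, hreal]
  simp only [Matrix.smul_mul, Matrix.one_mul, Matrix.zero_mul, add_zero, zero_add,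
    conjTranspose_zero, Matrix.mul_zero, conjTranspose_smul, conjTranspose_one, Matrix.mul_smul,
    Matrix.mul_one, smul_smul, Complex.star_def, Complex.conj_ofReal, trace_smul,
    Complex.add_re, hP, hQ] at h2
  rw [mul_comm _ c, hcc, smul_eq_mul, mul_comm _ (traceNorm A : ℂ), ht, Complex.ofReal_re] at h2
  linarith

theorem eq_zero_of_traceNorm_eq_zero {α : Type} [Fintype α] [DecidableEq α] {A : Matrix α α ℂ}
    (h : traceNorm A = 0) : A = 0 := by
  obtain ⟨V, U, σ, hσ, -, -, hA, -, -, htr⟩ := exists_svd A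
  rw [h, eq_comm, Finset.sum_eq_zero_iff_of_nonneg fun i _ => hσ i] at htr
  rw [hA, show (fun i => (σ i : ℂ)) = fun _ => 0 from funext fun i => by
    simp [htr i (Finset.mem_univ i)]]
  simp

open Matrix in
theorem traceNorm_submatrix_le {α β : Type} [Fintype α] [DecidableEq α] [Fintype β]
    [DecidableEq β] (e : β ≃ α) (A : Matrix α α ℂ) :
    traceNorm (A.submatrix e e) ≤ traceNorm A := by
  obtain ⟨P, Q, h, hP, hQ⟩ := exists_posSemidef_fromBlocks A
  have h1 : (fromBlocks (P.submatrix e e) (A.submatrix e e) (Aᴴ.submatrix e e)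
      (Q.submatrix e e)).PosSemidef := by
    have := h.submatrix (Sum.map e e)
    convert this using 1
    ext (i | i) (j | j) <;> rfl
  have h2 := traceNorm_le_of_posSemidef h1
  have ht : ∀ M : Matrix α α ℂ, (M.submatrix e e).trace = M.trace := fun M =>
    e.sum_comp fun i => M i i
  rw [ht, ht, hP, hQ] at h2
  simp at h2
  linarith

theorem traceNorm_submatrix {α β : Type} [Fintype α] [DecidableEq α] [Fintype β]
    [DecidableEq β] (e : β ≃ α) (A : Matrix α α ℂ) :
    traceNorm (A.submatrix e e) = traceNorm A := by
  refine le_antisymm (traceNorm_submatrix_le e A) ?_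
  have := traceNorm_submatrix_le e.symm (A.submatrix e e)
  simpa using this

/-! ### Bounds on diamond norms -/

/-- The superoperator `𝓘_R ⊗ T` for a reference system with an arbitrary finite basis `R`. -/
def ampliateOver (R : Type) {α β : Type} (T : Matrix α α ℂ →ₗ[ℂ] Matrix β β ℂ)
    (ρ : Matrix (R × α) (R × α) ℂ) : Matrix (R × β) (R × β) ℂ :=
  Matrix.of fun x y => T (ρ.submatrix (Prod.mk x.1) (Prod.mk y.1)) x.2 y.2

/-- `c` is an upper bound of the diamond norm of `T`. -/
def DiamondBound {α β : Type} [Fintype α] [DecidableEq α] [Fintype β] [DecidableEq β]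
    (T : Matrix α α ℂ →ₗ[ℂ] Matrix β β ℂ) (c : ℝ) : Prop :=
  ∀ (k : ℕ) (ρ : Matrix (Fin k × α) (Fin k × α) ℂ),
    traceNorm (ampliate k T ρ) ≤ c * traceNorm ρ

section

variable {α β γ : Type} [Fintype α] [DecidableEq α] [Fintype β] [DecidableEq β] [Fintype γ]
  [DecidableEq γ]

/-- Rescaling to trace norm one makes the bound homogeneous, the form in which bounds compose. -/
theorem diamondBound_of_diamondNorm_le {T : Matrix α α ℂ →ₗ[ℂ] Matrix β β ℂ} {c : ℝ}
    (hc : 0 ≤ c) (h : diamondNorm T ≤ ENNReal.ofReal c) : DiamondBound T c := by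
  intro k ρ
  by_cases h0 : traceNorm ρ = 0
  · rw [eq_zero_of_traceNorm_eq_zero h0, map_zero]
    have := traceNorm_smul_le 0 (0 : Matrix (Fin k × β) (Fin k × β) ℂ)
    simp only [zero_smul, norm_zero, zero_mul] at this
    exact this.trans (mul_nonneg hc (traceNorm_nonneg _))
  have hpos : 0 < traceNorm ρ := lt_of_le_of_ne (traceNorm_nonneg ρ) (Ne.symm h0)
  set t := traceNorm ρ with ht
  have hn : ‖((t⁻¹ : ℝ) : ℂ)‖ = t⁻¹ := by
    rw [Complex.norm_real, Real.norm_of_nonneg (inv_nonneg.2 hpos.le)]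
  have h1 : traceNorm (((t⁻¹ : ℝ) : ℂ) • ρ) ≤ 1 := by
    refine (traceNorm_smul_le _ _).trans ?_
    rw [hn, ← ht, inv_mul_cancel₀ h0]
  have h2 : ENNReal.ofReal (traceNorm (ampliate k T (((t⁻¹ : ℝ) : ℂ) • ρ))) ≤
      ENNReal.ofReal c := by
    refine le_trans ?_ h
    exact le_iSup_of_le k (le_iSup_of_le _ (le_iSup_of_le h1 le_rfl))
  rw [ENNReal.ofReal_le_ofReal_iff hc, map_smul] at h2
  have h3 := traceNorm_smul_le (t : ℂ) (((t⁻¹ : ℝ) : ℂ) • ampliate k T ρ)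
  have h4 : (t : ℂ) ≠ 0 := by exact_mod_cast h0
  rw [smul_smul, Complex.ofReal_inv, mul_inv_cancel₀ h4, one_smul, Complex.norm_real,
    Real.norm_of_nonneg hpos.le] at h3
  rw [Complex.ofReal_inv] at h2
  nlinarith

theorem DiamondBound.diamondNorm_le {T : Matrix α α ℂ →ₗ[ℂ] Matrix β β ℂ} {c : ℝ}
    (hc : 0 ≤ c) (h : DiamondBound T c) : diamondNorm T ≤ ENNReal.ofReal c :=
  iSup_le fun k => iSup_le fun ρ => iSup_le fun hρ =>
    ENNReal.ofReal_le_ofReal ((h k ρ).trans (mul_le_of_le_one_right hc hρ))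

theorem DiamondBound.mono {T : Matrix α α ℂ →ₗ[ℂ] Matrix β β ℂ} {c c' : ℝ}
    (h : DiamondBound T c) (hc : c ≤ c') : DiamondBound T c' := fun k ρ =>
  (h k ρ).trans (mul_le_mul_of_nonneg_right hc (traceNorm_nonneg ρ))

theorem DiamondBound.add {S T : Matrix α α ℂ →ₗ[ℂ] Matrix β β ℂ} {a b : ℝ}
    (hS : DiamondBound S a) (hT : DiamondBound T b) : DiamondBound (S + T) (a + b) := by
  intro k ρ
  have h : ampliate k (S + T) ρ = ampliate k S ρ + ampliate k T ρ := rfl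
  rw [h, add_mul]
  exact (traceNorm_add_le _ _).trans (add_le_add (hS k ρ) (hT k ρ))

theorem diamondBound_zero : DiamondBound (0 : Matrix α α ℂ →ₗ[ℂ] Matrix β β ℂ) 0 := by
  intro k ρ
  have h : ampliate k (0 : Matrix α α ℂ →ₗ[ℂ] Matrix β β ℂ) ρ = 0 := rfl
  have := traceNorm_smul_le 0 (0 : Matrix (Fin k × β) (Fin k × β) ℂ)
  simpa [h] using this

theorem DiamondBound.sum {ι : Type} {s : Finset ι} {T : ι → Matrix α α ℂ →ₗ[ℂ] Matrix β β ℂ}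
    {c : ι → ℝ} (h : ∀ i ∈ s, DiamondBound (T i) (c i)) :
    DiamondBound (∑ i ∈ s, T i) (∑ i ∈ s, c i) := by
  classical
  induction s using Finset.induction_on with
  | empty => simpa using diamondBound_zero
  | insert i s hi ih =>
    rw [Finset.sum_insert hi, Finset.sum_insert hi]
    exact (h i (Finset.mem_insert_self i s)).add
      (ih fun j hj => h j (Finset.mem_insert_of_mem hj))

theorem DiamondBound.comp {S : Matrix β β ℂ →ₗ[ℂ] Matrix γ γ ℂ}
    {T : Matrix α α ℂ →ₗ[ℂ] Matrix β β ℂ} {a b : ℝ} (ha : 0 ≤ a)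
    (hS : DiamondBound S a) (hT : DiamondBound T b) : DiamondBound (S ∘ₗ T) (a * b) := by
  intro k ρ
  have h : ampliate k (S ∘ₗ T) ρ = ampliate k S (ampliate k T ρ) := rfl
  rw [h, mul_assoc]
  exact (hS k _).trans (mul_le_mul_of_nonneg_left (hT k ρ) ha)

theorem ampliateOver_eq_submatrix {α β : Type} {R : Type} {k : ℕ} (e : R ≃ Fin k)
    (T : Matrix α α ℂ →ₗ[ℂ] Matrix β β ℂ) (ρ : Matrix (R × α) (R × α) ℂ) :
    ampliateOver R T ρ =
      (ampliate k T (ρ.submatrix (e.prodCongr (Equiv.refl α)).symm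
        (e.prodCongr (Equiv.refl α)).symm)).submatrix
        (e.prodCongr (Equiv.refl β)) (e.prodCongr (Equiv.refl β)) := by
  ext x y
  simp only [ampliateOver, ampliate, Matrix.of_apply, Matrix.submatrix_apply, LinearMap.coe_mk,
    AddHom.coe_mk, Equiv.prodCongr_apply, Prod.map, Equiv.refl_apply]
  refine congrArg (fun M => T M x.2 y.2) ?_
  ext a a'
  simp

theorem DiamondBound.ampliateOver {T : Matrix α α ℂ →ₗ[ℂ] Matrix β β ℂ} {c : ℝ}
    (h : DiamondBound T c) (R : Type) [Fintype R] [DecidableEq R]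
    (ρ : Matrix (R × α) (R × α) ℂ) : traceNorm (ampliateOver R T ρ) ≤ c * traceNorm ρ := by
  rw [ampliateOver_eq_submatrix (Fintype.equivFin R), traceNorm_submatrix]
  refine (h _ _).trans_eq ?_
  rw [traceNorm_submatrix]

open Matrix in
/-- Channels have diamond norm at most one. -/
theorem IsChannel.diamondBound {T : Matrix α α ℂ →ₗ[ℂ] Matrix β β ℂ} (hT : IsChannel T) :
    DiamondBound T 1 := by
  intro k ρ
  obtain ⟨P, Q, h, hP, hQ⟩ := exists_posSemidef_fromBlocks ρ
  have h1 := h.submatrix (Equiv.sumProdDistrib (Fin k) (Fin k) α)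
  -- A two-by-two block matrix is an operator with a doubled reference system, so complete
  -- positivity applies to all four blocks at once; trace preservation keeps the value of the
  -- semidefinite optimum.
  have h2 : (ampliateOver (Fin k ⊕ Fin k) T ((fromBlocks P ρ ρᴴ Q).submatrix
      (Equiv.sumProdDistrib (Fin k) (Fin k) α)
      (Equiv.sumProdDistrib (Fin k) (Fin k) α))).PosSemidef := by
    rw [ampliateOver_eq_submatrix finSumFinEquiv]
    exact (hT.completely_positive _ _ (h1.submatrix _)).submatrix _
  have h3 : (fromBlocks (ampliate k T P) (ampliate k T ρ) (ampliate k T ρᴴ)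
      (ampliate k T Q)).PosSemidef := by
    convert h2.submatrix (Equiv.sumProdDistrib (Fin k) (Fin k) β).symm using 1
    ext (i | i) (j | j) <;> rfl
  have htr : ∀ M : Matrix (Fin k × α) (Fin k × α) ℂ, (ampliate k T M).trace = M.trace := by
    intro M
    simp only [Matrix.trace, Fintype.sum_prod_type]
    exact Finset.sum_congr rfl fun i _ =>
      hT.trace_preserving (M.submatrix (Prod.mk i) (Prod.mk i))
  have h4 := traceNorm_le_of_posSemidef h3
  rw [htr, htr, hP, hQ] at h4
  simp at h4
  linarith

end

theorem apply_eq_sum_single {α β : Type} [Fintype α] [DecidableEq α]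
    (T : Matrix α α ℂ →ₗ[ℂ] Matrix β β ℂ) (ρ : Matrix α α ℂ) (b b' : β) :
    T ρ b b' = ∑ a, ∑ a', ρ a a' * T (Matrix.single a a' 1) b b' := by
  conv_lhs => rw [Matrix.matrix_eq_sum_single ρ]
  simp only [map_sum, Matrix.sum_apply]
  refine Finset.sum_congr rfl fun a _ => Finset.sum_congr rfl fun a' _ => ?_
  have : Matrix.single a a' (ρ a a') = ρ a a' • Matrix.single a a' (1 : ℂ) := by
    rw [Matrix.smul_single, smul_eq_mul, mul_one]
  rw [this, map_smul]
  rfl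

/-- The action of `𝓘_R ⊗ ⨂ i, T i`. -/
def ampliatePi (R : Type) {m : ℕ} {α β : Fin m → Type} [∀ i, Fintype (α i)]
    [∀ i, DecidableEq (α i)]
    (T : ∀ i, Matrix (α i) (α i) ℂ →ₗ[ℂ] Matrix (β i) (β i) ℂ)
    (ρ : Matrix (R × ∀ i, α i) (R × ∀ i, α i) ℂ) :
    Matrix (R × ∀ i, β i) (R × ∀ i, β i) ℂ :=
  Matrix.of fun x y => ∑ a : ∀ i, α i, ∑ a' : ∀ i, α i, ρ (x.1, a) (y.1, a') *
    ∏ i, T i (Matrix.single (a i) (a' i) 1) (x.2 i) (y.2 i)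

/-- The factors act one at a time, each treating all other tensor factors as part of its reference
system. This is why the reference has to be an arbitrary finite type in the induction. -/
theorem traceNorm_ampliatePi_le {m : ℕ} : ∀ {α β : Fin m → Type} [∀ i, Fintype (α i)]
    [∀ i, DecidableEq (α i)] [∀ i, Fintype (β i)] [∀ i, DecidableEq (β i)]
    {T : ∀ i, Matrix (α i) (α i) ℂ →ₗ[ℂ] Matrix (β i) (β i) ℂ} {c : Fin m → ℝ}
    (_ : ∀ i, 0 ≤ c i) (_ : ∀ i, DiamondBound (T i) (c i))
    (R : Type) [Fintype R] [DecidableEq R] (ρ : Matrix (R × ∀ i, α i) (R × ∀ i, α i) ℂ),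
    traceNorm (ampliatePi R T ρ) ≤ (∏ i, c i) * traceNorm ρ := by
  induction m with
  | zero =>
    intro α β _ _ _ _ T c hc hT R _ _ ρ
    have : ampliatePi R T ρ = ρ.submatrix
        ((Equiv.refl R).prodCongr (Equiv.ofUnique (∀ i, β i) (∀ i, α i)))
        ((Equiv.refl R).prodCongr (Equiv.ofUnique (∀ i, β i) (∀ i, α i))) := by
      ext x y
      simp only [ampliatePi, Matrix.of_apply, Finset.univ_eq_empty, Finset.prod_empty, mul_one,
        Finset.univ_unique, Finset.sum_singleton]
      rfl
    rw [this, traceNorm_submatrix]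
    simp
  | succ m ih =>
    intro α β _ _ _ _ T c hc hT R _ _ ρ
    let e₁ : (R × α 0) × (∀ i : Fin m, α i.succ) ≃ R × ∀ i, α i :=
      (Equiv.prodAssoc _ _ _).trans ((Equiv.refl R).prodCongr (Fin.consEquiv α))
    let e₂ : (R × ∀ i : Fin m, β i.succ) × α 0 ≃ (R × α 0) × ∀ i : Fin m, β i.succ :=
      ⟨fun x => ((x.1.1, x.2), x.1.2), fun x => ((x.1.1, x.2), x.1.2), fun _ => rfl, fun _ => rfl⟩
    let e₃ : (R × ∀ i, β i) ≃ (R × ∀ i : Fin m, β i.succ) × β 0 :=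
      ⟨fun x => ((x.1, fun i => x.2 i.succ), x.2 0), fun x => (x.1.1, Fin.cons x.2 x.1.2),
        fun x => by
          refine Prod.ext rfl ?_
          exact Fin.cons_self_tail x.2,
        fun x => rfl⟩
    -- The factors `1, …, m` act first, with the input of factor `0` in the reference; then factor
    -- `0` acts, with their outputs in the reference.
    have key : ampliatePi R T ρ = (ampliateOver (R × ∀ i : Fin m, β i.succ) (T 0)
        ((ampliatePi (R × α 0) (fun i : Fin m => T i.succ)
          (ρ.submatrix e₁ e₁)).submatrix e₂ e₂)).submatrix e₃ e₃ := by
      ext x y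
      simp only [ampliateOver, Matrix.submatrix_apply, Matrix.of_apply]
      rw [apply_eq_sum_single]
      simp only [ampliatePi, Matrix.of_apply, Matrix.submatrix_apply]
      rw [← (Fin.consEquiv α).sum_comp, Fintype.sum_prod_type]
      refine Finset.sum_congr rfl fun a _ => ?_
      have hr : ∀ a : ∀ i, α i, ∑ a' : ∀ i, α i, ρ (x.1, a) (y.1, a') *
          ∏ i, T i (Matrix.single (a i) (a' i) 1) (x.2 i) (y.2 i) =
          ∑ a0' : α 0, ∑ a' : ∀ i : Fin m, α i.succ, ρ (x.1, a) (y.1, Fin.consEquiv α (a0', a')) *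
          ∏ i, T i (Matrix.single (a i) (Fin.consEquiv α (a0', a') i) 1) (x.2 i) (y.2 i) := by
        intro a
        rw [← (Fin.consEquiv α).sum_comp, Fintype.sum_prod_type]
      simp only [hr]
      rw [Finset.sum_comm]
      refine Finset.sum_congr rfl fun a0' _ => ?_
      rw [Finset.sum_mul]
      refine Finset.sum_congr rfl fun b _ => ?_
      rw [Finset.sum_mul]
      refine Finset.sum_congr rfl fun b' _ => ?_
      rw [Fin.prod_univ_succ, mul_comm (T 0 _ _ _), ← mul_assoc]
      rfl
    rw [key, traceNorm_submatrix, Fin.prod_univ_succ, mul_assoc]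
    refine ((hT 0).ampliateOver _ _).trans (mul_le_mul_of_nonneg_left ?_ (hc 0))
    rw [traceNorm_submatrix]
    refine (ih (fun i => hc i.succ) (fun i => hT i.succ) _ _).trans_eq ?_
    rw [traceNorm_submatrix]

/-! ### Tensor products over the registers of a partition -/

/-- Bit strings on all wires correspond to families of bit strings on the registers. -/
def bitsEquiv {W J : Type} (f : W → J) : (W → Bool) ≃ ∀ j, (Register f j → Bool) where
  toFun a j w := a w.1
  invFun a w := a (f w) ⟨w, rfl⟩
  left_inv _ := rfl
  right_inv a := by
    funext j ⟨w, hw⟩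
    subst hw
    rfl

section

variable {W V J : Type} [Fintype W] [DecidableEq W] [Fintype V] [DecidableEq V] [Fintype J]
  [DecidableEq J]

/-- Distributivity: a bit string on all wires is an independent choice of a bit string on each
register. -/
theorem sum_prod_registers (f : W → J) (F : ∀ j, (Register f j → Bool) → ℂ) :
    ∑ a : W → Bool, ∏ j, F j (fun w => a w.1) = ∏ j, ∑ x, F j x := by
  rw [Finset.prod_univ_sum, Fintype.piFinset_univ]
  exact (bitsEquiv f).sum_comp fun x => ∏ j, F j (x j)

theorem sum_sum_prod_registers (f : W → J)
    (F : ∀ j, (Register f j → Bool) → (Register f j → Bool) → ℂ) :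
    ∑ a : W → Bool, ∑ a' : W → Bool, ∏ j, F j (fun w => a w.1) (fun w => a' w.1) =
      ∏ j, ∑ x, ∑ y, F j x y := by
  have h : ∀ a : W → Bool, ∑ a' : W → Bool, ∏ j, F j (fun w => a w.1) (fun w => a' w.1) =
      ∏ j, ∑ y, F j (fun w => a w.1) y := fun a =>
    sum_prod_registers f fun j => F j fun w => a w.1
  simp only [h]
  exact sum_prod_registers f fun j x => ∑ y, F j x y

theorem prod_registers_eq_ite {W J : Type} [Fintype W] [DecidableEq J] (f : W → J)
    (a b : W → Bool) (A : Finset J) :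
    (∏ j ∈ A, if (fun w : Register f j => a w.1) = (fun w => b w.1) then (1 : ℂ) else 0) =
      if ∀ w, f w ∈ A → a w = b w then 1 else 0 := by
  rw [Finset.prod_ite_zero, Finset.prod_const_one]
  congr 1
  rw [eq_iff_iff]
  constructor
  · intro h w hw
    exact congrFun (h (f w) hw) ⟨w, rfl⟩
  · intro h j hj
    funext w
    exact h w.1 (by rw [w.2]; exact hj)

/-- Diamond norm bounds are multiplicative under tensor products. -/
theorem diamondBound_tensorGates (f : W → J) (g : V → J)
    {T : ∀ j, Op (Register f j) →ₗ[ℂ] Op (Register g j)} {c : J → ℝ} (hc : ∀ j, 0 ≤ c j)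
    (hT : ∀ j, DiamondBound (T j) (c j)) : DiamondBound (tensorGates f g T) (∏ j, c j) := by
  intro k ρ
  let e : Fin (Fintype.card J) ≃ J := (Fintype.equivFin J).symm
  let p : ∀ {U : Type} (h : U → J), (U → Bool) ≃ ∀ i, (Register h (e i) → Bool) := fun h =>
    (bitsEquiv h).trans (Equiv.piCongrLeft _ e).symm
  have key : ampliate k (tensorGates f g T) ρ =
      (ampliatePi (Fin k) (fun i => T (e i)) (ρ.submatrix
        ((Equiv.refl _).prodCongr (p f)).symm ((Equiv.refl _).prodCongr (p f)).symm)).submatrix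
        ((Equiv.refl _).prodCongr (p g)) ((Equiv.refl _).prodCongr (p g)) := by
    ext x y
    simp only [ampliate, tensorGates, ampliatePi, Matrix.of_apply, Matrix.submatrix_apply,
      LinearMap.coe_mk, AddHom.coe_mk]
    rw [← (p f).sum_comp]
    refine Finset.sum_congr rfl fun a _ => ?_
    rw [← (p f).sum_comp]
    refine Finset.sum_congr rfl fun a' _ => ?_
    congr 1
    · simp
    · exact (e.prod_comp fun j => T j (Matrix.single (fun w => a w.1) (fun w => a' w.1) 1)
        (fun v => x.2 v.1) (fun v => y.2 v.1)).symm
  rw [key, traceNorm_submatrix]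
  refine (traceNorm_ampliatePi_le (fun i => hc (e i)) (fun i => hT (e i)) _ _).trans_eq ?_
  rw [traceNorm_submatrix, e.prod_comp]

theorem tensorGates_apply {V : Type} [Fintype V] (f : W → J) (g : V → J)
    (T : ∀ j, Op (Register f j) →ₗ[ℂ] Op (Register g j)) (ρ : Op W) (b b' : V → Bool) :
    tensorGates f g T ρ b b' = ∑ a : W → Bool, ∑ a' : W → Bool, ρ a a' *
      ∏ j, T j (Matrix.single (fun w => a w.1) (fun w => a' w.1) 1)
        (fun v => b v.1) (fun v => b' v.1) := rfl

theorem sum_sum_comm_sum_sum {κ ι : Type} [Fintype κ] [Fintype ι] (F : κ → κ → ι → ι → ℂ) :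
    ∑ c, ∑ c', ∑ a, ∑ a', F c c' a a' = ∑ a, ∑ a', ∑ c, ∑ c', F c c' a a' := by
  simp only [← Fintype.sum_prod_type']
  have h := Finset.sum_comm (s := Finset.univ) (t := Finset.univ)
    (f := fun (x : κ × κ) (y : ι × ι) => F x.1 x.2 y.1 y.2)
  simpa only [Fintype.sum_prod_type] using h

/-- The sum over intermediate bit strings factors over the registers of `g`. -/
theorem tensorGates_comp {X : Type} [Fintype X] (f : W → J) (g : V → J) (h : X → J)
    (S : ∀ j, Op (Register g j) →ₗ[ℂ] Op (Register h j))
    (T : ∀ j, Op (Register f j) →ₗ[ℂ] Op (Register g j)) :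
    tensorGates g h S ∘ₗ tensorGates f g T = tensorGates f h fun j => S j ∘ₗ T j := by
  refine LinearMap.ext fun ρ => ?_
  ext b b'
  rw [LinearMap.comp_apply, tensorGates_apply, tensorGates_apply]
  simp only [tensorGates_apply, Finset.sum_mul]
  have hr : ∀ a a' : W → Bool,
      ∏ j, (S j ∘ₗ T j) (Matrix.single (fun w => a w.1) (fun w => a' w.1) 1)
        (fun v => b v.1) (fun v => b' v.1) =
      ∑ c : V → Bool, ∑ c' : V → Bool,
        (∏ j, T j (Matrix.single (fun w => a w.1) (fun w => a' w.1) 1)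
          (fun v => c v.1) (fun v => c' v.1)) *
        ∏ j, S j (Matrix.single (fun w => c w.1) (fun w => c' w.1) 1)
          (fun v => b v.1) (fun v => b' v.1) := by
    intro a a'
    simp only [LinearMap.comp_apply, ← Finset.prod_mul_distrib]
    rw [sum_sum_prod_registers g fun j x y =>
      T j (Matrix.single (fun w => a w.1) (fun w => a' w.1) 1) x y *
        S j (Matrix.single x y 1) (fun v => b v.1) (fun v => b' v.1)]
    exact Finset.prod_congr rfl fun j _ => apply_eq_sum_single _ _ _ _
  simp only [hr, Finset.mul_sum, ← mul_assoc]
  exact sum_sum_comm_sum_sum _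

/-- The multilinear expansion of a tensor product of sums. -/
theorem tensorGates_add {V : Type} [Fintype V] (f : W → J) (g : V → J)
    (D T : ∀ j, Op (Register f j) →ₗ[ℂ] Op (Register g j)) :
    tensorGates f g (fun j => D j + T j) =
      ∑ A : Finset J, tensorGates f g fun j => if j ∈ A then D j else T j := by
  refine LinearMap.ext fun ρ => ?_
  ext b b'
  rw [LinearMap.sum_apply, Matrix.sum_apply]
  simp only [tensorGates_apply]
  refine Eq.trans ?_ Finset.sum_comm
  refine Finset.sum_congr rfl fun a _ => ?_
  refine Eq.trans ?_ Finset.sum_comm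
  refine Finset.sum_congr rfl fun a' _ => ?_
  rw [← Finset.mul_sum]
  congr 1
  simp only [LinearMap.add_apply, Matrix.add_apply]
  rw [Finset.prod_add, Finset.powerset_univ]
  refine Finset.sum_congr rfl fun A _ => ?_
  rw [← Finset.prod_sdiff (Finset.subset_univ A), mul_comm]
  congr 1
  · refine Finset.prod_congr rfl fun j hj => ?_
    rw [if_neg (Finset.mem_sdiff.1 hj).2]
  · refine Finset.prod_congr rfl fun j hj => ?_
    rw [if_pos hj]

/-- The tensor product of operators on the registers. -/
def tensorOp (f : W → J) (E : ∀ j, Op (Register f j)) : Op W :=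
  Matrix.of fun x y => ∏ j, E j (fun w => x w.1) (fun w => y w.1)

theorem tensorOp_mul (f : W → J) (E F : ∀ j, Op (Register f j)) :
    tensorOp f E * tensorOp f F = tensorOp f fun j => E j * F j := by
  ext x y
  simp only [tensorOp, Matrix.mul_apply, Matrix.of_apply, ← Finset.prod_mul_distrib]
  exact sum_prod_registers f fun j z => E j (fun w => x w.1) z * F j z (fun w => y w.1)

theorem tensorOp_one {W : Type} [Fintype W] (f : W → J) : tensorOp f (fun _ => 1) = 1 := by
  ext x y
  simp only [tensorOp, Matrix.of_apply, Matrix.one_apply]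
  rw [prod_registers_eq_ite]
  simp [funext_iff]

theorem tensorOp_conjTranspose {W J : Type} [Fintype J] (f : W → J) (E : ∀ j, Op (Register f j)) :
    (tensorOp f E)ᴴ = tensorOp f fun j => (E j)ᴴ := by
  ext x y
  simp [tensorOp, Matrix.conjTranspose_apply]

theorem sandwich_single_apply {α : Type} [Fintype α] [DecidableEq α] (E F : Matrix α α ℂ)
    (a a' b b' : α) : sandwich E F (Matrix.single a a' 1) b b' = E b a * F a' b' := by
  simp only [sandwich, LinearMap.coe_mk, AddHom.coe_mk]
  rw [Matrix.mul_assoc, Matrix.mul_apply, Finset.sum_eq_single a]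
  · rw [Matrix.single_mul_apply_same, one_mul]
  · intro c _ hc
    rw [Matrix.single_mul_apply_of_ne _ _ _ _ _ hc, mul_zero]
  · simp

theorem linearMap_ext_single {α β : Type} [Fintype α] [DecidableEq α]
    {S T : Matrix α α ℂ →ₗ[ℂ] Matrix β β ℂ}
    (h : ∀ a a', S (Matrix.single a a' 1) = T (Matrix.single a a' 1)) : S = T := by
  refine LinearMap.ext fun ρ => ?_
  ext b b'
  rw [apply_eq_sum_single S, apply_eq_sum_single T]
  simp only [h]

theorem tensorGates_single_apply {V : Type} [Fintype V] (f : W → J) (g : V → J)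
    (T : ∀ j, Op (Register f j) →ₗ[ℂ] Op (Register g j)) (a a' : W → Bool) (b b' : V → Bool) :
    tensorGates f g T (Matrix.single a a' 1) b b' =
      ∏ j, T j (Matrix.single (fun w => a w.1) (fun w => a' w.1) 1)
        (fun v => b v.1) (fun v => b' v.1) := by
  rw [tensorGates_apply, Finset.sum_eq_single a, Finset.sum_eq_single a']
  · simp
  · intro c _ hc; simp [Ne.symm hc]
  · simp
  · intro c _ hc; simp [Ne.symm hc]
  · simp

theorem tensorGates_sandwich (f : W → J) (E F : ∀ j, Op (Register f j)) :
    tensorGates f f (fun j => sandwich (E j) (F j)) = sandwich (tensorOp f E) (tensorOp f F) := by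
  refine linearMap_ext_single fun a a' => ?_
  ext b b'
  rw [tensorGates_single_apply, sandwich_single_apply]
  simp only [sandwich_single_apply, Finset.prod_mul_distrib]
  rfl

end

/-! ### Weights of operators -/

/-- Extension of a bit string on `A` by zeros. -/
def extendBits {W : Type} [DecidableEq W] (A : Finset W) (p : {w // w ∈ A} → Bool) : W → Bool :=
  fun w => if h : w ∈ A then p ⟨w, h⟩ else false

theorem extendBits_of_mem {W : Type} [DecidableEq W] {A : Finset W} (x : W → Bool) {w : W}
    (h : w ∈ A) : extendBits A (fun w => x w) w = x w := by
  simp [extendBits, h]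

theorem extendBits_of_notMem {W : Type} [DecidableEq W] {A : Finset W}
    (p : {w // w ∈ A} → Bool) {w : W} (h : w ∉ A) : extendBits A p w = false := by
  simp [extendBits, h]

section

variable {W J : Type} [Fintype W] [DecidableEq W] [Fintype J] [DecidableEq J]

/-- The wires of the locations in `A`. -/
def wires (f : W → J) (A : Finset J) : Finset W := Finset.univ.filter fun w => f w ∈ A

theorem mem_wires {W J : Type} [Fintype W] [DecidableEq J] {f : W → J} {A : Finset J}
    {w : W} : w ∈ wires f A ↔ f w ∈ A := by
  simp [wires]

/-- The operator on the wires of `A` is read off by padding bit strings with zeros: an identity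
factor has entry `1` at the zero string, and it vanishes as soon as the two bit strings differ on
its register. -/
theorem tensorOp_eq_extendOp (f : W → J) {E : ∀ j, Op (Register f j)} {A : Finset J}
    (hE : ∀ j, j ∉ A → E j = 1) : ∃ F, tensorOp f E = extendOp (wires f A) F := by
  refine ⟨Matrix.of fun p q =>
    tensorOp f E (extendBits (wires f A) p) (extendBits (wires f A) q), ?_⟩
  ext x y
  simp only [extendOp, Matrix.of_apply, tensorOp]
  split_ifs with h
  · refine Finset.prod_congr rfl fun j _ => ?_
    by_cases hj : j ∈ A
    · have hx : ∀ x : W → Bool, (fun w : Register f j =>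
          extendBits (wires f A) (fun q => x q) w.1) = fun w => x w.1 := fun x =>
        funext fun w => extendBits_of_mem x (mem_wires.2 (by rw [w.2]; exact hj))
      rw [hx, hx]
    · have hw : ∀ w : Register f j, w.1 ∉ wires f A := fun w => by
        rw [mem_wires, w.2]; exact hj
      have h1 : (fun w : Register f j => x w.1) = fun w => y w.1 :=
        funext fun w => h _ (hw w)
      have h2 : ∀ x : W → Bool, (fun w : Register f j =>
          extendBits (wires f A) (fun q => x q) w.1) = fun _ => false := fun x =>
        funext fun w => extendBits_of_notMem _ (hw w)
      rw [hE j hj, h1, h2, h2, Matrix.one_apply_eq, Matrix.one_apply_eq]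
  · push Not at h
    obtain ⟨w, hw, hne⟩ := h
    rw [mem_wires] at hw
    refine Finset.prod_eq_zero (Finset.mem_univ (f w)) ?_
    rw [hE _ hw, Matrix.one_apply_ne]
    exact fun h => hne (congrFun h ⟨w, rfl⟩)

theorem tensorOp_mem_operatorsOfWeight (f : W → J) {E : ∀ j, Op (Register f j)} {A : Finset J}
    (hE : ∀ j, j ∉ A → E j = 1) {z : ℝ} (hz : ((wires f A).card : ℝ) ≤ z) :
    tensorOp f E ∈ operatorsOfWeight W z :=
  Submodule.subset_span ⟨_, hz, tensorOp_eq_extendOp f hE⟩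

/-- Operators supported on `A` are combinations of tensor products over the registers that are
trivial on the registers disjoint from `A`. -/
theorem extendOp_mem_span_tensorOp (f : W → J) (A : Finset W) (E : Op {w // w ∈ A}) :
    extendOp A E ∈ Submodule.span ℂ
      {X | ∃ F : ∀ j, Op (Register f j), (∀ j, j ∉ A.image f → F j = 1) ∧ X = tensorOp f F} := by
  -- The matrix unit `|p⟩⟨q|` on `A`, extended by the identity, is a product over single wires with
  -- these entries; grouping the wires by location yields the factors `F p q`.
  let e : ({w // w ∈ A} → Bool) → ({w // w ∈ A} → Bool) → W → Bool → Bool → ℂ := fun p q w s t =>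
    if h : w ∈ A then if s = p ⟨w, h⟩ ∧ t = q ⟨w, h⟩ then 1 else 0 else if s = t then 1 else 0
  let F : ({w // w ∈ A} → Bool) → ({w // w ∈ A} → Bool) → ∀ j, Op (Register f j) :=
    fun p q j => Matrix.of fun x y => ∏ w : Register f j, e p q w.1 (x w) (y w)
  have key : extendOp A E = ∑ p, ∑ q, E p q • tensorOp f (F p q) := by
    ext x y
    have hF : ∀ p q, tensorOp f (F p q) x y =
        if (∀ w, w ∉ A → x w = y w) ∧ (fun w => x w.1) = p ∧ (fun w => y w.1) = q
          then 1 else 0 := by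
      intro p q
      have h1 : tensorOp f (F p q) x y = ∏ w, e p q w (x w) (y w) := by
        simp only [tensorOp, F, Matrix.of_apply]
        rw [← Fintype.prod_sigma']
        exact (Equiv.sigmaFiberEquiv f).prod_comp fun w => e p q w (x w) (y w)
      rw [h1]
      split_ifs with h
      · obtain ⟨h0, rfl, rfl⟩ := h
        refine Finset.prod_eq_one fun w _ => ?_
        by_cases hw : w ∈ A
        · simp [e, hw]
        · simp [e, hw, h0 w hw]
      · by_contra hne
        rw [← ne_eq, Finset.prod_ne_zero_iff] at hne
        refine h ⟨fun w hw => ?_, funext fun w => ?_, funext fun w => ?_⟩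
        · by_contra hxy
          exact hne w (Finset.mem_univ w) (by simp [e, hw, hxy])
        · by_contra hxy
          exact hne w (Finset.mem_univ _) (by simp [e, hxy])
        · by_contra hxy
          exact hne w (Finset.mem_univ _) (by simp [e, hxy])
    simp only [Matrix.sum_apply, Matrix.smul_apply, hF, smul_eq_mul, extendOp, Matrix.of_apply]
    split_ifs with h
    · rw [Finset.sum_eq_single fun w => x w.1, Finset.sum_eq_single fun w => y w.1]
      · rw [if_pos ⟨h, rfl, rfl⟩, mul_one]
      · intro q _ hq
        rw [if_neg fun h' => hq h'.2.2.symm, mul_zero]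
      · simp
      · intro p _ hp
        exact Finset.sum_eq_zero fun q _ => by rw [if_neg fun h' => hp h'.2.1.symm, mul_zero]
      · simp
    · exact (Finset.sum_eq_zero fun p _ => Finset.sum_eq_zero fun q _ => by
        rw [if_neg fun h' => h h'.1, mul_zero]).symm
  rw [key]
  refine Submodule.sum_mem _ fun p _ => Submodule.sum_mem _ fun q _ =>
    Submodule.smul_mem _ _ (Submodule.subset_span ⟨_, fun j hj => ?_, rfl⟩)
  ext x y
  have hw : ∀ w : Register f j, w.1 ∉ A := fun w hw =>
    hj (Finset.mem_image.2 ⟨w.1, hw, w.2⟩)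
  simp only [F, e, Matrix.of_apply, hw, dite_false, Matrix.one_apply]
  rw [Finset.prod_ite_zero, Finset.prod_const_one]
  simp [funext_iff]

theorem operatorsOfWeight_le_span_tensorOp (f : W → J) (z : ℝ) :
    operatorsOfWeight W z ≤ Submodule.span ℂ {X | ∃ A : Finset W, (A.card : ℝ) ≤ z ∧
      ∃ F : ∀ j, Op (Register f j), (∀ j, j ∉ A.image f → F j = 1) ∧ X = tensorOp f F} := by
  refine Submodule.span_le.2 ?_
  rintro _ ⟨A, hA, E, rfl⟩
  refine Submodule.span_mono ?_ (extendOp_mem_span_tensorOp f A E)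
  rintro _ ⟨F, hF, rfl⟩
  exact ⟨A, hA, F, hF, rfl⟩

theorem operatorsOfWeight_mono {a b : ℝ} (h : a ≤ b) :
    operatorsOfWeight W a ≤ operatorsOfWeight W b :=
  Submodule.span_mono fun _ ⟨A, hA, hE⟩ => ⟨A, hA.trans h, hE⟩

theorem superoperatorsOfWeight_mono {a b : ℝ} (h : a ≤ b) :
    superoperatorsOfWeight W a ≤ superoperatorsOfWeight W b :=
  Submodule.span_mono fun _ ⟨E₁, h₁, E₂, h₂, hT⟩ =>
    ⟨E₁, operatorsOfWeight_mono h h₁, E₂, operatorsOfWeight_mono h h₂, hT⟩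

/-- For the partition into single wires, a product of two tensor products is trivial off the union
of the two supports. -/
theorem mul_mem_operatorsOfWeight {a b : ℝ} {X Y : Op W} (hX : X ∈ operatorsOfWeight W a)
    (hY : Y ∈ operatorsOfWeight W b) : X * Y ∈ operatorsOfWeight W (a + b) := by
  have h := Submodule.mul_mem_mul (operatorsOfWeight_le_span_tensorOp id a hX)
    (operatorsOfWeight_le_span_tensorOp id b hY)
  rw [Submodule.span_mul_span] at h
  refine Submodule.span_le.2 ?_ h
  rintro _ ⟨_, ⟨A, hA, F, hF, rfl⟩, _, ⟨B, hB, G, hG, rfl⟩, rfl⟩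
  simp only [Finset.image_id] at hF hG
  simp only [tensorOp_mul]
  refine tensorOp_mem_operatorsOfWeight (A := A ∪ B) id (fun j hj => ?_) ?_
  · rw [Finset.notMem_union] at hj
    rw [hF j hj.1, hG j hj.2, mul_one]
  · have h1 : wires id (A ∪ B) = A ∪ B := by ext; simp [mem_wires]
    rw [h1]
    have := Finset.card_union_le A B
    have : ((A ∪ B).card : ℝ) ≤ A.card + B.card := by exact_mod_cast this
    linarith

/-- At a location that the operator does not touch, `U j` cancels against its adjoint. At most `z`
locations are touched, and each holds at most two wires. -/
theorem conj_mem_operatorsOfWeight {f : W → J}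
    (hf : ∀ A : Finset J, (wires f A).card ≤ 2 * A.card) {U : ∀ j, Op (Register f j)}
    (hU : ∀ j, U j * (U j)ᴴ = 1) {z : ℝ} {X : Op W} (hX : X ∈ operatorsOfWeight W z) :
    tensorOp f U * X * (tensorOp f U)ᴴ ∈ operatorsOfWeight W (2 * z) := by
  have h := operatorsOfWeight_le_span_tensorOp f z hX
  have h2 : Submodule.span ℂ {X | ∃ A : Finset W, (A.card : ℝ) ≤ z ∧
      ∃ F : ∀ j, Op (Register f j), (∀ j, j ∉ A.image f → F j = 1) ∧ X = tensorOp f F} ≤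
      (operatorsOfWeight W (2 * z)).comap (sandwich (tensorOp f U) (tensorOp f U)ᴴ) := by
    refine Submodule.span_le.2 ?_
    rintro _ ⟨A, hA, F, hF, rfl⟩
    change tensorOp f U * tensorOp f F * (tensorOp f U)ᴴ ∈ operatorsOfWeight W (2 * z)
    rw [tensorOp_conjTranspose, tensorOp_mul, tensorOp_mul]
    refine tensorOp_mem_operatorsOfWeight (A := A.image f) f (fun j hj => ?_) ?_
    · rw [hF j hj, Matrix.mul_one, hU]
    · have h1 := (hf (A.image f)).trans (Nat.mul_le_mul_left 2 Finset.card_image_le)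
      have : ((wires f (A.image f)).card : ℝ) ≤ 2 * A.card := by exact_mod_cast h1
      linarith
  exact h2 h

theorem sandwich_comp_sandwich (A B C D : Op W) :
    sandwich A B ∘ₗ sandwich C D = sandwich (A * C) (D * B) := by
  refine LinearMap.ext fun ρ => ?_
  simp [sandwich, Matrix.mul_assoc]

theorem comp_mem_superoperatorsOfWeight {a b : ℝ} {N M : Op W →ₗ[ℂ] Op W}
    (hN : N ∈ superoperatorsOfWeight W a) (hM : M ∈ superoperatorsOfWeight W b) :
    N ∘ₗ M ∈ superoperatorsOfWeight W (a + b) := by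
  have h := Submodule.mul_mem_mul (A := Module.End ℂ (Op W)) hN hM
  rw [superoperatorsOfWeight, superoperatorsOfWeight, Submodule.span_mul_span] at h
  refine Submodule.span_le.2 ?_ h
  rintro _ ⟨_, ⟨E₁, h₁, E₂, h₂, rfl⟩, _, ⟨F₁, k₁, F₂, k₂, rfl⟩, rfl⟩
  refine Submodule.subset_span ⟨E₁ * F₁, mul_mem_operatorsOfWeight h₁ k₁, E₂ * F₂,
    mul_mem_operatorsOfWeight h₂ k₂, ?_⟩
  rw [Matrix.conjTranspose_mul]
  exact sandwich_comp_sandwich _ _ _ _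

/-- Moving a superoperator through a layer of unitary gates doubles its weight at most. -/
theorem exists_comm_tensorGates {f : W → J}
    (hf : ∀ A : Finset J, (wires f A).card ≤ 2 * A.card) {U : ∀ j, Op (Register f j)}
    (hU : ∀ j, U j * (U j)ᴴ = 1) {z : ℝ} {N : Op W →ₗ[ℂ] Op W}
    (hN : N ∈ superoperatorsOfWeight W z) :
    ∃ N' ∈ superoperatorsOfWeight W (2 * z),
      tensorGates f f (fun j => sandwich (U j) (U j)ᴴ) ∘ₗ N =
        N' ∘ₗ tensorGates f f (fun j => sandwich (U j) (U j)ᴴ) := by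
  have hUU : (tensorOp f U)ᴴ * tensorOp f U = 1 := by
    rw [tensorOp_conjTranspose, tensorOp_mul, ← tensorOp_one f]
    congr 1
    funext j
    exact mul_eq_one_comm.1 (hU j)
  rw [tensorGates_sandwich, ← tensorOp_conjTranspose]
  set V := tensorOp f U with hV
  -- The new superoperator is the conjugate of `N` by the layer; on a map `E₁ · E₂ᴴ` it conjugates
  -- `E₁` and `E₂` by the same unitary.
  refine ⟨sandwich V Vᴴ ∘ₗ N ∘ₗ sandwich Vᴴ V, ?_, ?_⟩
  · have h : superoperatorsOfWeight W z ≤ (superoperatorsOfWeight W (2 * z)).comap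
        ((LinearMap.llcomp ℂ _ _ _ (sandwich V Vᴴ)) ∘ₗ
          (LinearMap.lcomp ℂ (Op W) (sandwich Vᴴ V))) := by
      refine Submodule.span_le.2 ?_
      rintro _ ⟨E₁, h₁, E₂, h₂, rfl⟩
      refine Submodule.subset_span ⟨_, conj_mem_operatorsOfWeight hf hU h₁, _,
        conj_mem_operatorsOfWeight hf hU h₂, ?_⟩
      change sandwich V Vᴴ ∘ₗ sandwich E₁ E₂ᴴ ∘ₗ sandwich Vᴴ V = _
      rw [sandwich_comp_sandwich, sandwich_comp_sandwich, ← hV]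
      simp [Matrix.mul_assoc]
    exact h hN
  · have : sandwich Vᴴ V ∘ₗ sandwich V Vᴴ = LinearMap.id := by
      rw [sandwich_comp_sandwich, hUU]
      refine LinearMap.ext fun ρ => ?_
      simp [sandwich]
    rw [LinearMap.comp_assoc, LinearMap.comp_assoc, this, LinearMap.comp_id]

/-- Where the gates are the identity they only copy row and column indices. The map is therefore a
combination of sandwiches by matrix units on the wires of `A`. -/
theorem tensorGates_mem_superoperatorsOfWeight (f : W → J)
    {N : ∀ j, Op (Register f j) →ₗ[ℂ] Op (Register f j)} {A : Finset J}
    (hN : ∀ j, j ∉ A → N j = LinearMap.id) {z : ℝ} (hz : ((wires f A).card : ℝ) ≤ z) :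
    tensorGates f f N ∈ superoperatorsOfWeight W z := by
  let u : (W → Bool) → {w // w ∈ wires f A} → Bool := fun x w => x w.1
  let v := extendBits (wires f A)
  let c : ({w // w ∈ wires f A} → Bool) → ({w // w ∈ wires f A} → Bool) →
      ({w // w ∈ wires f A} → Bool) → ({w // w ∈ wires f A} → Bool) → ℂ := fun p q r s =>
    tensorGates f f N (Matrix.single (v p) (v q) 1) (v r) (v s)
  have key : tensorGates f f N = ∑ p, ∑ q, ∑ r, ∑ s, c p q r s •
      sandwich (extendOp _ (Matrix.single r p 1)) (extendOp _ (Matrix.single s q 1))ᴴ := by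
    refine linearMap_ext_single fun a a' => ?_
    ext b b'
    simp only [LinearMap.sum_apply, LinearMap.smul_apply, Matrix.sum_apply, Matrix.smul_apply,
      sandwich_single_apply, Matrix.conjTranspose_apply]
    -- Only the matrix units that match the restrictions of the four bit strings to the wires of `A`
    -- contribute.
    rw [Finset.sum_eq_single (u a), Finset.sum_eq_single (u a'), Finset.sum_eq_single (u b),
      Finset.sum_eq_single (u b')]
    rotate_left
    · intro s _ hs
      simp [extendOp, Matrix.single_apply, show s ≠ fun w => b' w.1 from hs]
    · simp
    · intro r _ hr
      simp [extendOp, Matrix.single_apply, show r ≠ fun w => b w.1 from hr]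
    · simp
    · intro q _ hq
      simp [extendOp, Matrix.single_apply, show q ≠ fun w => a' w.1 from hq]
    · simp
    · intro p _ hp
      simp [extendOp, Matrix.single_apply, show p ≠ fun w => a w.1 from hp]
    · simp
    have hE : ∀ x y, extendOp (wires f A) (Matrix.single (u x) (u y) (1 : ℂ)) x y =
        if ∀ q, q ∉ wires f A → x q = y q then 1 else 0 := by
      intro x y
      simp [extendOp, u]
    rw [hE, hE]
    simp only [c, tensorGates_single_apply]
    -- If input and output bits agree off these wires, each identity factor gives `1` on both sides;
    -- otherwise both sides vanish.
    by_cases h : (∀ q, q ∉ wires f A → b q = a q) ∧ ∀ q, q ∉ wires f A → b' q = a' q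
    · rw [if_pos h.1, if_pos h.2, star_one, mul_one, smul_eq_mul, mul_one]
      refine Finset.prod_congr rfl fun j _ => ?_
      by_cases hj : j ∈ A
      · have hx : ∀ x : W → Bool, (fun w : Register f j => v (u x) w.1) = fun w => x w.1 :=
          fun x => funext fun w => extendBits_of_mem x (mem_wires.2 (by rw [w.2]; exact hj))
        rw [hx, hx, hx, hx]
      · have hw : ∀ w : Register f j, w.1 ∉ wires f A := fun w => by
          rw [mem_wires, w.2]; exact hj
        have h1 : (fun w : Register f j => b w.1) = fun w => a w.1 :=
          funext fun w => h.1 _ (hw w)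
        have h1' : (fun w : Register f j => b' w.1) = fun w => a' w.1 :=
          funext fun w => h.2 _ (hw w)
        have h2 : ∀ x : W → Bool, (fun w : Register f j => v (u x) w.1) = fun _ => false :=
          fun x => funext fun w => extendBits_of_notMem _ (hw w)
        rw [hN j hj, h1, h1', h2, h2, h2, h2]
        simp
    · have hz : (if ∀ q, q ∉ wires f A → b q = a q then (1 : ℂ) else 0) *
          star (if ∀ q, q ∉ wires f A → b' q = a' q then (1 : ℂ) else 0) = 0 := by
        rcases not_and_or.1 h with h | h
        · rw [if_neg h, zero_mul]
        · rw [if_neg h, star_zero, mul_zero]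
      rw [hz, smul_zero]
      rcases not_and_or.1 h with h | h
      all_goals
        push Not at h
        obtain ⟨w, hw, hne⟩ := h
        rw [mem_wires] at hw
        refine Finset.prod_eq_zero (Finset.mem_univ (f w)) ?_
        rw [hN _ hw, LinearMap.id_apply, Matrix.single_apply, if_neg]
      · exact fun h => hne (congrFun h.1 ⟨w, rfl⟩).symm
      · exact fun h => hne (congrFun h.2 ⟨w, rfl⟩).symm
  rw [key]
  exact Submodule.sum_mem _ fun p _ => Submodule.sum_mem _ fun q _ => Submodule.sum_mem _
    fun r _ => Submodule.sum_mem _ fun s _ => Submodule.smul_mem _ _ (Submodule.subset_span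
      ⟨_, Submodule.subset_span ⟨_, hz, _, rfl⟩, _, Submodule.subset_span ⟨_, hz, _, rfl⟩, rfl⟩)

end

/-! ### The ideal gates are channels -/

theorem isChannel_of_kraus {α β ι : Type} [Fintype α] [DecidableEq α] [Fintype β] [Fintype ι]
    {T : Matrix α α ℂ →ₗ[ℂ] Matrix β β ℂ} (K : ι → Matrix β α ℂ)
    (hT : ∀ ρ, T ρ = ∑ s, K s * ρ * (K s)ᴴ) (hK : ∑ s, (K s)ᴴ * K s = 1) : IsChannel T where
  completely_positive k ρ hρ := by
    have key : ampliate k T ρ = ∑ s, Matrix.kroneckerMap (· * ·) (1 : Matrix (Fin k) (Fin k) ℂ)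
        (K s) * ρ * (Matrix.kroneckerMap (· * ·) (1 : Matrix (Fin k) (Fin k) ℂ) (K s))ᴴ := by
      ext ⟨i, b⟩ ⟨j, b'⟩
      simp only [ampliate, LinearMap.coe_mk, AddHom.coe_mk, Matrix.of_apply, hT,
        Matrix.sum_apply]
      refine Finset.sum_congr rfl fun s _ => ?_
      simp [Matrix.mul_apply, Fintype.sum_prod_type, Matrix.one_apply, apply_ite]
    rw [key]
    exact Matrix.posSemidef_sum _ fun s _ => hρ.mul_mul_conjTranspose_same _
  trace_preserving ρ := by
    simp only [hT, Matrix.trace_sum]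
    have : ∀ s, (K s * ρ * (K s)ᴴ).trace = ((K s)ᴴ * K s * ρ).trace := fun s => by
      rw [Matrix.trace_mul_comm, Matrix.mul_assoc]
    simp only [this]
    rw [← Matrix.trace_sum, ← Finset.sum_mul, hK, one_mul]

theorem isChannel_of_submatrix {α β : Type} [Fintype α] [Fintype β]
    {T : Matrix α α ℂ →ₗ[ℂ] Matrix β β ℂ} (e : β ≃ α) (hT : ∀ ρ, T ρ = ρ.submatrix e e) :
    IsChannel T where
  completely_positive k ρ hρ := by
    have key : ampliate k T ρ = ρ.submatrix (Prod.map id e) (Prod.map id e) := by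
      ext x y
      simp only [ampliate, hT]
      rfl
    rw [key]
    exact hρ.submatrix _
  trace_preserving ρ := by
    rw [hT]
    exact e.sum_comp fun i => ρ i i

theorem isChannel_sandwich {α : Type} [Fintype α] [DecidableEq α] {U : Matrix α α ℂ}
    (hU : Uᴴ * U = 1) : IsChannel (sandwich U Uᴴ) :=
  isChannel_of_kraus (fun _ : Unit => U) (fun ρ => by simp [sandwich]) (by simpa using hU)

namespace PauliBasis

variable {R : Type} [Fintype R] [DecidableEq R]

theorem sum_star_amplitude_mul (B : PauliBasis) (s t : Bool) :
    ∑ x, star (B.amplitude s x) * B.amplitude t x = if s = t then 1 else 0 := by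
  have h : ((Real.sqrt 2 : ℝ) : ℂ)⁻¹ * ((Real.sqrt 2 : ℝ) : ℂ)⁻¹ = 1 / 2 := by
    rw [← mul_inv, ← Complex.ofReal_mul, Real.mul_self_sqrt (by norm_num)]
    norm_num
  cases B <;> cases s <;> cases t <;> (simp [amplitude, h]; try norm_num)

theorem star_ket_dotProduct_ket (B : PauliBasis) (s t : R → Bool) :
    star (B.ket s) ⬝ᵥ B.ket t = if s = t then 1 else 0 := by
  simp only [dotProduct, ket, Pi.star_apply, star_prod, ← Finset.prod_mul_distrib]
  have h := (Finset.prod_univ_sum (fun _ : R => (Finset.univ : Finset Bool))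
    fun r x => star (B.amplitude (s r) x) * B.amplitude (t r) x).symm
  rw [Fintype.piFinset_univ] at h
  rw [h]
  simp only [sum_star_amplitude_mul]
  rw [Finset.prod_ite_zero, Finset.prod_const_one]
  simp [funext_iff]

theorem isChannel_prepare (B : PauliBasis) (R' : Type) [Fintype R'] [DecidableEq R'] [IsEmpty R'] :
    IsChannel (B.prepare R' R) := by
  refine isChannel_of_kraus
    (fun _ : Unit => Matrix.of fun x (_ : R' → Bool) => B.ket (fun _ : R => false) x) ?_ ?_
  · intro ρ
    ext x y
    simp [prepare, Matrix.mul_apply, Matrix.vecMulVec_apply, Matrix.trace]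
    ring
  · ext x y
    have h := B.star_ket_dotProduct_ket (fun _ : R => false) fun _ => false
    rw [if_pos rfl] at h
    rw [Subsingleton.elim x y, Matrix.one_apply_eq, ← h]
    simp [Matrix.mul_apply, dotProduct]

/-- The kets are orthonormal and as many as the dimension: a one-sided inverse of a square matrix is
two-sided. -/
theorem sum_vecMulVec_ket (B : PauliBasis) :
    ∑ s : R → Bool, Matrix.vecMulVec (B.ket s) (star (B.ket s)) = 1 := by
  let M : Matrix (R → Bool) (R → Bool) ℂ := Matrix.of fun s x => star (B.ket s x)
  have h : M * Mᴴ = 1 := by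
    ext s t
    rw [Matrix.one_apply, ← B.star_ket_dotProduct_ket s t]
    simp [M, Matrix.mul_apply, dotProduct]
  rw [← mul_eq_one_comm.1 h]
  ext x y
  simp [M, Matrix.mul_apply, Matrix.sum_apply, Matrix.vecMulVec_apply]

theorem isChannel_measure (B : PauliBasis) : IsChannel (B.measure R) := by
  -- The Kraus operators are `|s⟩⟨v_s|`.
  refine isChannel_of_kraus
    (fun s : R → Bool => Matrix.vecMulVec (Pi.single s 1) (star (B.ket s))) ?_ ?_
  · intro ρ
    have h : ∀ s : R → Bool, Matrix.vecMulVec (Pi.single s (1 : ℂ)) (star (B.ket s)) * ρ *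
        (Matrix.vecMulVec (Pi.single s (1 : ℂ)) (star (B.ket s)))ᴴ =
        (star (B.ket s) ⬝ᵥ (ρ *ᵥ B.ket s)) • Matrix.single s s (1 : ℂ) := by
      intro s
      rw [Matrix.conjTranspose_vecMulVec, star_star, Matrix.vecMulVec_mul,
        Matrix.vecMulVec_mul_vecMulVec, ← Matrix.dotProduct_mulVec]
      ext x y
      simp [Matrix.vecMulVec_apply, Matrix.single_apply, Pi.single_apply]
      grind
    simp only [h, measure, LinearMap.coe_mk, AddHom.coe_mk]
    ext x y
    simp only [Matrix.sum_apply, Matrix.diagonal_apply, Matrix.smul_apply, Matrix.single_apply,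
      smul_eq_mul, mul_ite, mul_one, mul_zero]
    rw [Finset.sum_eq_single x]
    · simp
    · intro s _ hs
      rw [if_neg fun h => hs h.1]
    · simp
  · rw [← B.sum_vecMulVec_ket]
    refine Finset.sum_congr rfl fun s _ => ?_
    rw [Matrix.conjTranspose_vecMulVec, star_star, Matrix.vecMulVec_mul_vecMulVec]
    simp

/-- The state with diagonal entries given by those of `X`, in the measurement basis. -/
noncomputable def dephase (B : PauliBasis) (R : Type) [Fintype R] [DecidableEq R] :
    Op R →ₗ[ℂ] Op R where
  toFun X := ∑ s, X s s • Matrix.vecMulVec (B.ket s) (star (B.ket s))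
  map_add' X Y := by simp [add_smul, Finset.sum_add_distrib]
  map_smul' c X := by simp [Finset.smul_sum, smul_smul]

/-- By orthonormality, measuring a mixture of basis states returns its weights. So the measurement
has a right inverse on classical outputs. -/
theorem measure_dephase (B : PauliBasis) {X : Op R} (hX : X.IsDiag) :
    B.measure R (B.dephase R X) = X := by
  have h : ∀ s : R → Bool, star (B.ket s) ⬝ᵥ ((∑ t, X t t •
      Matrix.vecMulVec (B.ket t) (star (B.ket t))) *ᵥ B.ket s) = X s s := by
    intro s
    rw [Matrix.sum_mulVec, dotProduct_sum]
    rw [Finset.sum_eq_single s]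
    · simp [Matrix.smul_mulVec, Matrix.vecMulVec_mulVec, star_ket_dotProduct_ket]
    · intro t _ ht
      simp [Matrix.smul_mulVec, Matrix.vecMulVec_mulVec, star_ket_dotProduct_ket, ht]
    · simp
  simp only [measure, dephase, LinearMap.coe_mk, AddHom.coe_mk, h]
  exact hX.diagonal_diag

end PauliBasis

/-! ### Truncating the expansion of a noisy layer -/

theorem DiamondBound.neg {α β : Type} [Fintype α] [DecidableEq α] [Fintype β] [DecidableEq β]
    {T : Matrix α α ℂ →ₗ[ℂ] Matrix β β ℂ} {c : ℝ} (h : DiamondBound T c) :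
    DiamondBound (-T) c := by
  intro k ρ
  have h1 : ampliate k (-T) ρ = (-1 : ℂ) • ampliate k T ρ := by
    rw [neg_one_smul]; rfl
  rw [h1]
  refine (traceNorm_smul_le _ _).trans ?_
  rw [norm_neg, norm_one, one_mul]
  exact h k ρ

/-- Chernoff bound: on the tail `exp(|A| - 10μ) ≥ 1`, and inserting this factor allows the sum to
run over all sets. The binomial theorem then gives `exp(-10μ) (1 + eδ)^|J| ≤ exp((2e - 10)μ)`, and
`10 - 2e > 1/3`. -/
theorem sum_pow_card_le {J : Type} [Fintype J] {δ μ : ℝ} (hδ : 0 ≤ δ) (hμ : 0 ≤ μ)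
    (hJ : Fintype.card J * δ ≤ 2 * μ) :
    ∑ A : Finset J with 10 * μ < A.card, δ ^ A.card ≤ Real.exp (-(μ / 3)) := by
  classical
  have h1 : ∀ A ∈ Finset.univ.filter (fun A : Finset J => 10 * μ < A.card),
      δ ^ A.card ≤ Real.exp (-(10 * μ)) * (δ * Real.exp 1) ^ A.card := by
    intro A hA
    have hA' := (Finset.mem_filter.1 hA).2
    rw [mul_pow, mul_comm (δ ^ _), ← mul_assoc, ← Real.exp_nat_mul, ← Real.exp_add]
    refine le_mul_of_one_le_left (pow_nonneg hδ _) (Real.one_le_exp ?_)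
    linarith
  refine (Finset.sum_le_sum h1).trans ?_
  have hx : 0 ≤ δ * Real.exp 1 := mul_nonneg hδ (Real.exp_pos 1).le
  refine (Finset.sum_le_univ_sum_of_nonneg fun A => by positivity).trans ?_
  rw [← Finset.mul_sum]
  have h2 := Finset.sum_pow_mul_eq_add_pow (δ * Real.exp 1) 1 (Finset.univ : Finset J)
  simp only [one_pow, mul_one, Finset.powerset_univ, Finset.card_univ] at h2
  rw [h2]
  have h3 : (δ * Real.exp 1 + 1) ^ Fintype.card J ≤
      Real.exp (Fintype.card J * (δ * Real.exp 1)) := by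
    rw [Real.exp_nat_mul]
    exact pow_le_pow_left₀ (by positivity) (Real.add_one_le_exp _) _
  refine (mul_le_mul_of_nonneg_left h3 (Real.exp_pos _).le).trans ?_
  rw [← Real.exp_add]
  apply Real.exp_le_exp.2
  have he := Real.exp_one_lt_d9
  have h4 : Fintype.card J * (δ * Real.exp 1) ≤ 2 * μ * Real.exp 1 := by
    rw [← mul_assoc]
    exact mul_le_mul_of_nonneg_right hJ (Real.exp_pos 1).le
  nlinarith

section

variable {W V J : Type} [Fintype W] [DecidableEq W] [Fintype V] [DecidableEq V] [Fintype J]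
  [DecidableEq J]

/-- The terms of the expansion of `⨂ j, (D j + T j)` with at most `K` factors `D j`. -/
noncomputable def truncatedLayer (f : W → J) (g : V → J)
    (D T : ∀ j, Op (Register f j) →ₗ[ℂ] Op (Register g j)) (K : ℝ) : Op W →ₗ[ℂ] Op V :=
  ∑ A : Finset J with ¬ K < A.card, tensorGates f g fun j => if j ∈ A then D j else T j

/-- The difference consists of the terms with more than `10μ` error factors; each error factor
contributes `δ`, and each ideal one, being a channel, contributes `1`. -/
theorem diamondBound_sub_truncatedLayer (f : W → J) (g : V → J)
    {T T' : ∀ j, Op (Register f j) →ₗ[ℂ] Op (Register g j)} {δ μ : ℝ} (hδ : 0 ≤ δ) (hμ : 0 ≤ μ)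
    (hJ : Fintype.card J * δ ≤ 2 * μ) (hT : ∀ j, IsChannel (T j))
    (hT' : ∀ j, IsNoisyVersion δ (T j) (T' j)) :
    DiamondBound (tensorGates f g T' - truncatedLayer f g (fun j => T' j - T j) T (10 * μ))
      (Real.exp (-(μ / 3))) := by
  have h1 : tensorGates f g T' - truncatedLayer f g (fun j => T' j - T j) T (10 * μ) =
      ∑ A : Finset J with 10 * μ < A.card,
        tensorGates f g fun j => if j ∈ A then T' j - T j else T j := by
    have h := tensorGates_add f g (fun j => T' j - T j) T
    simp only [sub_add_cancel] at h
    rw [h, truncatedLayer, sub_eq_iff_eq_add, Finset.sum_filter_add_sum_filter_not]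
  rw [h1]
  refine (DiamondBound.sum fun A _ => ?_).mono (sum_pow_card_le hδ hμ hJ)
  have h2 : δ ^ A.card = ∏ j, if j ∈ A then δ else 1 := by
    rw [Finset.prod_ite_mem, Finset.univ_inter, Finset.prod_const]
  rw [h2]
  refine diamondBound_tensorGates f g (fun j => ?_) fun j => ?_
  · split_ifs <;> positivity
  · split_ifs
    · exact diamondBound_of_diamondNorm_le hδ (hT' j).2
    · exact (hT j).diamondBound

theorem diamondBound_tensorGates_noisy (f : W → J) (g : V → J)
    {T T' : ∀ j, Op (Register f j) →ₗ[ℂ] Op (Register g j)} {δ : ℝ}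
    (hT' : ∀ j, IsNoisyVersion δ (T j) (T' j)) : DiamondBound (tensorGates f g T') 1 := by
  have := diamondBound_tensorGates f g (fun _ => zero_le_one) fun j => (hT' j).1.diamondBound
  simpa using this

theorem truncatedLayer_id_mem_superoperatorsOfWeight (f : W → J) {k K : ℝ} (hk : 0 ≤ k)
    (hf : ∀ A : Finset J, ((wires f A).card : ℝ) ≤ k * A.card)
    (N : ∀ j, Op (Register f j) →ₗ[ℂ] Op (Register f j)) :
    truncatedLayer f f N (fun _ => LinearMap.id) K ∈ superoperatorsOfWeight W (k * K) := by
  refine Submodule.sum_mem _ fun A hA => tensorGates_mem_superoperatorsOfWeight f (A := A) ?_ ?_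
  · intro j hj
    rw [if_neg hj]
  · exact (hf A).trans (mul_le_mul_of_nonneg_left (not_lt.1 (Finset.mem_filter.1 hA).2) hk)

/-- The factorization holds term by term: the ideal layer acts everywhere, followed by `N j` on `A`
and the identity elsewhere. -/
theorem truncatedLayer_eq_comp (f : W → J) (g : V → J)
    {D T : ∀ j, Op (Register f j) →ₗ[ℂ] Op (Register g j)}
    {N : ∀ j, Op (Register g j) →ₗ[ℂ] Op (Register g j)} (h : ∀ j, D j = N j ∘ₗ T j) (K : ℝ) :
    truncatedLayer f g D T K =
      truncatedLayer g g N (fun _ => LinearMap.id) K ∘ₗ tensorGates f g T := by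
  have hs : ∀ (s : Finset (Finset J)) (F : Finset J → Op V →ₗ[ℂ] Op V),
      (∑ A ∈ s, F A) ∘ₗ tensorGates f g T = ∑ A ∈ s, F A ∘ₗ tensorGates f g T := fun s F =>
    LinearMap.ext fun ρ => by simp [LinearMap.sum_apply]
  simp only [truncatedLayer, hs, tensorGates_comp]
  refine Finset.sum_congr rfl fun A _ => congrArg _ (funext fun j => ?_)
  split_ifs
  · exact h j
  · rfl

theorem truncatedLayer_eq_comp' (f : W → J) (g : V → J)
    {D T : ∀ j, Op (Register f j) →ₗ[ℂ] Op (Register g j)}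
    {N : ∀ j, Op (Register f j) →ₗ[ℂ] Op (Register f j)} (h : ∀ j, D j = T j ∘ₗ N j) (K : ℝ) :
    truncatedLayer f g D T K =
      tensorGates f g T ∘ₗ truncatedLayer f f N (fun _ => LinearMap.id) K := by
  have hs : ∀ (s : Finset (Finset J)) (F : Finset J → Op W →ₗ[ℂ] Op W),
      tensorGates f g T ∘ₗ (∑ A ∈ s, F A) = ∑ A ∈ s, tensorGates f g T ∘ₗ F A := fun s F =>
    LinearMap.ext fun ρ => by simp [LinearMap.sum_apply]
  simp only [truncatedLayer, hs, tensorGates_comp]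
  refine Finset.sum_congr rfl fun A _ => congrArg _ (funext fun j => ?_)
  split_ifs
  · exact h j
  · rfl

/-- Accumulation of the errors of the layers of unitary gates. -/
theorem exists_approx_composeLayers {K x : ℝ} (hx : 0 ≤ x) {S₀ S₀' : Op V →ₗ[ℂ] Op W}
    (h₀ : DiamondBound S₀' 1)
    (hN₀ : ∃ N ∈ superoperatorsOfWeight W K, DiamondBound (S₀' - N ∘ₗ S₀) x) {m : ℕ}
    {F F' : Fin m → (Op W →ₗ[ℂ] Op W)} (h1 : ∀ i, DiamondBound (F' i) 1)
    (h2 : ∀ i, ∃ N ∈ superoperatorsOfWeight W (2 * K), DiamondBound (F' i - N ∘ₗ F i) x)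
    (h3 : ∀ i z, ∀ N ∈ superoperatorsOfWeight W z,
      ∃ N' ∈ superoperatorsOfWeight W (2 * z), F i ∘ₗ N = N' ∘ₗ F i) :
    DiamondBound (SyndromeCircuit.composeLayers m F' ∘ₗ S₀') 1 ∧
      ∃ N ∈ superoperatorsOfWeight W (K * (3 * 2 ^ m - 2)),
        DiamondBound (SyndromeCircuit.composeLayers m F' ∘ₗ S₀' -
          N ∘ₗ SyndromeCircuit.composeLayers m F ∘ₗ S₀) ((1 + x) ^ (m + 1) - 1) := by
  induction m with
  | zero =>
    refine ⟨by simpa [SyndromeCircuit.composeLayers] using h₀, ?_⟩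
    obtain ⟨N, hN, hb⟩ := hN₀
    refine ⟨N, by convert hN using 2; norm_num, ?_⟩
    simpa [SyndromeCircuit.composeLayers] using hb
  | succ m ih =>
    obtain ⟨hb, N, hN, hd⟩ := ih (fun i => h1 i.castSucc) (fun i => h2 i.castSucc)
      (fun i => h3 i.castSucc)
    obtain ⟨M, hM, hMd⟩ := h2 (Fin.last m)
    obtain ⟨N', hN', hcomm⟩ := h3 (Fin.last m) _ N hN
    simp only [SyndromeCircuit.composeLayers]
    set S' := SyndromeCircuit.composeLayers m (fun i => F' i.castSucc) ∘ₗ S₀' with hS'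
    set S := SyndromeCircuit.composeLayers m (fun i => F i.castSucc) ∘ₗ S₀ with hS
    rw [LinearMap.comp_assoc, LinearMap.comp_assoc, ← hS', ← hS]
    refine ⟨by simpa using (h1 (Fin.last m)).comp zero_le_one hb, M ∘ₗ N', ?_, ?_⟩
    -- A new layer sends the accumulated weight `w` to `2K + 2w`; starting from `K`, this recursion
    -- has the solution `K(3·2^m - 2)`.
    · have := comp_mem_superoperatorsOfWeight hM hN'
      convert this using 2
      ring
    -- The approximating prefix need not be a channel; its norm is bounded through its distance to
    -- the noisy prefix, which has norm at most `1`.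
    · have hbar : DiamondBound (N ∘ₗ S) ((1 + x) ^ (m + 1)) := by
        have := hb.add hd.neg
        rw [← sub_eq_add_neg, sub_sub_cancel] at this
        exact this.mono (by linarith)
      -- Hybrid argument: the prefix is replaced under the noisy layer, then the layer is replaced
      -- on the approximating prefix.
      have e : F' (Fin.last m) ∘ₗ S' - (M ∘ₗ N') ∘ₗ F (Fin.last m) ∘ₗ S =
          F' (Fin.last m) ∘ₗ (S' - N ∘ₗ S) +
            (F' (Fin.last m) - M ∘ₗ F (Fin.last m)) ∘ₗ (N ∘ₗ S) := by
        rw [LinearMap.comp_sub, LinearMap.sub_comp, sub_add_sub_cancel]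
        congr 1
        rw [LinearMap.comp_assoc, LinearMap.comp_assoc, ← LinearMap.comp_assoc _ N, hcomm]
        rfl
      rw [e]
      refine (((h1 _).comp zero_le_one hd).add (hMd.comp hx hbar)).mono (le_of_eq ?_)
      ring

end

/-- With `y = d x`, the power is at most `exp y`, and `1 - exp(-y) ≤ y` gives `exp y - 1 ≤ y exp y`.
The hypothesis forces `y ≤ 1/e < 1`, hence strictness. -/
theorem one_add_pow_sub_one_lt {x : ℝ} {d : ℕ} (hx : 0 < x) (hd : 0 < d)
    (h : x ≤ 1 / (Real.exp 1 * d)) : (1 + x) ^ d - 1 < Real.exp 1 * d * x := by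
  have hd' : (0 : ℝ) < d := by exact_mod_cast hd
  have hy : 0 < d * x := by positivity
  have he := Real.exp_pos 1
  have h1 : d * x < 1 := by
    rw [le_div_iff₀ (by positivity)] at h
    nlinarith [Real.exp_one_gt_d9]
  have h2 : (1 + x) ^ d ≤ Real.exp (d * x) := by
    rw [Real.exp_nat_mul]
    exact pow_le_pow_left₀ (by positivity) (by linarith [Real.add_one_le_exp x]) _
  have h3 : Real.exp (d * x) - 1 ≤ d * x * Real.exp (d * x) := by
    have := Real.add_one_le_exp (-(d * x))
    have h4 := mul_le_mul_of_nonneg_right this (Real.exp_pos (d * x)).le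
    rw [← Real.exp_add, neg_add_cancel, Real.exp_zero] at h4
    linarith
  have h4 : d * x * Real.exp (d * x) < d * x * Real.exp 1 :=
    mul_lt_mul_of_pos_left (Real.exp_lt_exp.2 h1) hy
  linarith

/-! ### The layers of a syndrome extraction circuit -/

namespace SyndromeCircuit

variable {n l : ℕ} (Φ : SyndromeCircuit n l)

instance isEmpty_register_inl (a : Fin l) :
    IsEmpty (Register (Sum.inl : Fin n → Qubits n l) (Sum.inr a)) :=
  ⟨fun w => Sum.inl_ne_inr w.2⟩

/-- The bit of a data qubit as an input and as an output of the first layer. -/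
def dataBitEquiv (i : Fin n) :
    (Register (id : Qubits n l → _) (Sum.inl i) → Bool) ≃
      (Register (Sum.inl : Fin n → Qubits n l) (Sum.inl i) → Bool) where
  toFun x _ := x ⟨Sum.inl i, rfl⟩
  invFun y _ := y ⟨i, rfl⟩
  left_inv x := by
    funext ⟨w, hw⟩
    cases hw
    rfl
  right_inv y := by
    funext ⟨w, hw⟩
    cases hw
    rfl

theorem initGate_inl (i : Fin n)
    (ρ : Op (Register (Sum.inl : Fin n → Qubits n l) (Sum.inl i))) :
    Φ.initGate (Sum.inl i) ρ = ρ.submatrix (dataBitEquiv i) (dataBitEquiv i) := rfl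

theorem isChannel_initGate : ∀ j, IsChannel (Φ.initGate j)
  | .inl i => isChannel_of_submatrix (dataBitEquiv i) (Φ.initGate_inl i)
  | .inr a => (Φ.prepBasis a).isChannel_prepare _

theorem isChannel_measGate : ∀ j, IsChannel (Φ.measGate j)
  | .inl _ => isChannel_of_submatrix (Equiv.refl _) fun _ => rfl
  | .inr a => (Φ.measBasis a).isChannel_measure

/-- An idle gate only relabels wires. A preparation has an empty input register, so its inputs are
scalars, and the trace recovers them. -/
theorem exists_leftInverse_initGate :
    ∀ j, ∃ L, L ∘ₗ Φ.initGate j = LinearMap.id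
  | .inl i => by
    refine ⟨(Matrix.reindexLinearEquiv ℂ ℂ (dataBitEquiv i) (dataBitEquiv i)).toLinearMap,
      LinearMap.ext fun ρ => ?_⟩
    rw [LinearMap.comp_apply, initGate_inl]
    ext x y
    simp
  | .inr a => by
    refine ⟨(Matrix.traceLinearMap _ ℂ ℂ).smulRight 1, LinearMap.ext fun ρ => ?_⟩
    have h := (Φ.isChannel_initGate (.inr a)).trace_preserving ρ
    ext x y
    simp only [LinearMap.comp_apply, LinearMap.smulRight_apply, Matrix.traceLinearMap_apply, h,
      LinearMap.id_apply, Matrix.smul_apply, smul_eq_mul]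
    rw [Subsingleton.elim x default, Subsingleton.elim y default, Matrix.one_apply_eq, mul_one]
    simp only [Matrix.trace, Matrix.diag_apply, Fintype.sum_unique]
    exact congrArg₂ ρ (Subsingleton.elim _ _) (Subsingleton.elim _ _)

/-- An idle gate can be dropped; at an ancilla the error is classical, and the right inverse of the
measurement on diagonal matrices applies. -/
theorem exists_eq_measGate_comp (j : Qubits n l)
    {D : Op (Register (id : Qubits n l → _) j) →ₗ[ℂ] Op (Register (id : Qubits n l → _) j)}
    (hD : ∀ a, j = Sum.inr a → ∀ ρ, (D ρ).IsDiag) : ∃ N, D = Φ.measGate j ∘ₗ N := by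
  match j with
  | .inl i => exact ⟨D, rfl⟩
  | .inr a =>
    refine ⟨(Φ.measBasis a).dephase _ ∘ₗ D, LinearMap.ext fun ρ => ?_⟩
    exact ((Φ.measBasis a).measure_dephase (hD a rfl ρ)).symm

end SyndromeCircuit

theorem card_wires_id_le {J : Type} [Fintype J] [DecidableEq J] (A : Finset J) :
    ((wires id A).card : ℝ) ≤ 1 * A.card := by
  rw [show wires id A = A by ext; simp [mem_wires], one_mul]

namespace EntanglingLayer

variable {n l : ℕ} (L : EntanglingLayer n l)

/-- A location contains at most one data qubit and at most one ancilla qubit. -/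
theorem card_wires_le (A : Finset (Fin L.size)) : (wires L.loc A).card ≤ 2 * A.card := by
  have h : wires L.loc A =
      (Finset.univ.filter fun i : Fin n => L.loc (Sum.inl i) ∈ A).disjSum
        (Finset.univ.filter fun a : Fin l => L.loc (Sum.inr a) ∈ A) := by
    ext (i | a) <;> simp [mem_wires]
  rw [h, Finset.card_disjSum, two_mul]
  refine add_le_add ?_ ?_
  · exact Finset.card_le_card_of_injOn (fun i => L.loc (Sum.inl i)) (fun i hi => by simpa using hi)
      L.data_injective.injOn
  · exact Finset.card_le_card_of_injOn (fun a => L.loc (Sum.inr a)) (fun a ha => by simpa using ha)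
      L.ancilla_injective.injOn

theorem size_le : L.size ≤ n + l := by
  simpa using Fintype.card_le_of_surjective _ L.loc_surjective

theorem gate_mul_conjTranspose (j : Fin L.size) : L.gate j * (L.gate j)ᴴ = 1 :=
  (Matrix.mem_unitaryGroup_iff.1 (L.gate_unitary j))

theorem conjTranspose_mul_gate (j : Fin L.size) : (L.gate j)ᴴ * L.gate j = 1 :=
  mul_eq_one_comm.1 (L.gate_mul_conjTranspose j)

theorem isChannel_gateChannel (j : Fin L.size) : IsChannel (L.gateChannel j) :=
  isChannel_sandwich (L.conjTranspose_mul_gate j)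

theorem leftInverse_gateChannel (j : Fin L.size) :
    sandwich (L.gate j)ᴴ (L.gate j) ∘ₗ L.gateChannel j = LinearMap.id := by
  rw [gateChannel, sandwich_comp_sandwich, conjTranspose_mul_gate]
  refine LinearMap.ext fun ρ => ?_
  simp [sandwich]

end EntanglingLayer

theorem mainTheorem3 (n l : ℕ) (hl : l < n) (Φ : SyndromeCircuit n l)
    (δ : ℝ) (hδ0 : 0 ≤ δ) (hδ1 : δ ≤ 1)
    (hn : Real.exp (-(n * δ / 3)) ≤ 1 / (Real.exp 1 * Φ.depth))
    (T : Op (Fin n) →ₗ[ℂ] Op (Qubits n l)) (hT : T ∈ Φ.noisyRealizations δ) :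
    ∃ Tbar : Op (Fin n) →ₗ[ℂ] Op (Qubits n l),
      diamondNorm (T - Tbar) <
          ENNReal.ofReal (Real.exp 1 * Φ.depth * Real.exp (-(n * δ / 3))) ∧
        ∃ N ∈ superoperatorsOfWeight (Qubits n l) (5 * n * δ * 2 ^ (Φ.depth + 1)),
          Tbar = Φ.measurementChannel ∘ₗ N ∘ₗ Φ.channelBeforeMeasurement := by
  obtain ⟨init, mid, meas, hinit, hmid, hmeas, hdiag, rfl⟩ := hT
  set μ : ℝ := n * δ with hμ
  have hμ0 : 0 ≤ μ := by positivity
  set x := Real.exp (-(μ / 3)) with hx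
  have hx0 : 0 < x := Real.exp_pos _
  have hcard : ∀ m : ℕ, m ≤ n + l → m * δ ≤ 2 * μ := by
    intro m hm
    -- This is where `l < n` enters: a layer has at most `2n` locations.
    have h2 : (m : ℝ) ≤ 2 * n := by exact_mod_cast (by omega : m ≤ 2 * n)
    calc m * δ ≤ 2 * n * δ := mul_le_mul_of_nonneg_right h2 hδ0
      _ = 2 * μ := by rw [hμ]; ring
  have hcardQ : Fintype.card (Qubits n l) * δ ≤ 2 * μ := hcard _ (by simp)
  have h₀ : ∃ N ∈ superoperatorsOfWeight (Qubits n l) (10 * μ),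
      DiamondBound (tensorGates Sum.inl id init - N ∘ₗ tensorGates Sum.inl id Φ.initGate) x := by
    choose L hL using Φ.exists_leftInverse_initGate
    have h := diamondBound_sub_truncatedLayer Sum.inl id hδ0 hμ0 hcardQ Φ.isChannel_initGate hinit
    rw [truncatedLayer_eq_comp (N := fun j => (init j - Φ.initGate j) ∘ₗ L j) _ _
      fun j => by rw [LinearMap.comp_assoc, hL, LinearMap.comp_id]] at h
    refine ⟨_, ?_, h⟩
    simpa using truncatedLayer_id_mem_superoperatorsOfWeight (K := 10 * μ) id zero_le_one
      card_wires_id_le fun j => (init j - Φ.initGate j) ∘ₗ L j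
  have h₁ : ∀ i, ∃ N ∈ superoperatorsOfWeight (Qubits n l) (2 * (10 * μ)),
      DiamondBound (tensorGates (Φ.layer i).loc (Φ.layer i).loc (mid i) -
        N ∘ₗ tensorGates (Φ.layer i).loc (Φ.layer i).loc (Φ.layer i).gateChannel) x := by
    intro i
    have h := diamondBound_sub_truncatedLayer (Φ.layer i).loc (Φ.layer i).loc hδ0 hμ0
      (hcard _ (by simpa using (Φ.layer i).size_le)) (Φ.layer i).isChannel_gateChannel (hmid i)
    rw [truncatedLayer_eq_comp (N := fun j => (mid i j - (Φ.layer i).gateChannel j) ∘ₗ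
      sandwich ((Φ.layer i).gate j)ᴴ ((Φ.layer i).gate j)) _ _
      fun j => by
        rw [LinearMap.comp_assoc, EntanglingLayer.leftInverse_gateChannel, LinearMap.comp_id]] at h
    exact ⟨_, truncatedLayer_id_mem_superoperatorsOfWeight _ zero_le_two
      (fun A => by exact_mod_cast (Φ.layer i).card_wires_le A) _, h⟩
  obtain ⟨hb, N, hN, hd⟩ := exists_approx_composeLayers hx0.le
    (diamondBound_tensorGates_noisy Sum.inl id hinit) h₀
    (fun i => diamondBound_tensorGates_noisy _ _ (hmid i)) h₁
    (fun i z N hN => exists_comm_tensorGates (Φ.layer i).card_wires_le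
      (Φ.layer i).gate_mul_conjTranspose hN)
  have h₂ : ∃ M ∈ superoperatorsOfWeight (Qubits n l) (10 * μ),
      DiamondBound (tensorGates id id meas - Φ.measurementChannel ∘ₗ M) x := by
    -- Both the noisy and the ideal measurement have diagonal outputs, hence so does their
    -- difference.
    have hD : ∀ j, ∃ N, meas j - Φ.measGate j = Φ.measGate j ∘ₗ N := by
      intro j
      refine Φ.exists_eq_measGate_comp j ?_
      rintro a rfl ρ
      exact (hdiag a ρ).sub (Matrix.isDiag_diagonal _)
    choose M hM using hD
    have h := diamondBound_sub_truncatedLayer id id hδ0 hμ0 hcardQ Φ.isChannel_measGate hmeas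
    rw [truncatedLayer_eq_comp' _ _ hM] at h
    refine ⟨_, ?_, h⟩
    simpa using truncatedLayer_id_mem_superoperatorsOfWeight (K := 10 * μ) id zero_le_one
      card_wires_id_le M
  obtain ⟨M, hM, hMd⟩ := h₂
  -- The measurement errors `M` sit before the ideal measurement, and the errors `N` of all earlier
  -- layers after the last unitary layer, so the two are adjacent.
  refine ⟨Φ.measurementChannel ∘ₗ (M ∘ₗ N) ∘ₗ Φ.channelBeforeMeasurement, ?_, M ∘ₗ N, ?_, rfl⟩
  · set S' := SyndromeCircuit.composeLayers Φ.numEntangling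
      (fun i => tensorGates (Φ.layer i).loc (Φ.layer i).loc (mid i)) ∘ₗ tensorGates Sum.inl id init
      with hS'
    change DiamondBound (S' - N ∘ₗ Φ.channelBeforeMeasurement) _ at hd
    have hbar : DiamondBound (N ∘ₗ Φ.channelBeforeMeasurement)
        ((1 + x) ^ (Φ.numEntangling + 1)) := by
      have := hb.add hd.neg
      rw [← sub_eq_add_neg, sub_sub_cancel] at this
      exact this.mono (by linarith)
    have e : tensorGates id id meas ∘ₗ S' -
        Φ.measurementChannel ∘ₗ (M ∘ₗ N) ∘ₗ Φ.channelBeforeMeasurement =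
        tensorGates id id meas ∘ₗ (S' - N ∘ₗ Φ.channelBeforeMeasurement) +
        (tensorGates id id meas - Φ.measurementChannel ∘ₗ M) ∘ₗ
          (N ∘ₗ Φ.channelBeforeMeasurement) := by
      rw [LinearMap.comp_sub, LinearMap.sub_comp, sub_add_sub_cancel]
      rfl
    rw [e]
    -- With `m` unitary layers the bounds add up as `(1 + x)^(m+1) - 1 + x (1 + x)^(m+1) = (1 +
    -- x)^(m+2) - 1`, where `m + 2` is the depth.
    have hfin := (((diamondBound_tensorGates_noisy id id hmeas).comp zero_le_one hd).add
      (hMd.comp hx0.le hbar)).mono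
      (show _ ≤ (1 + x) ^ Φ.depth - 1 from le_of_eq (by rw [SyndromeCircuit.depth]; ring))
    have hlt := one_add_pow_sub_one_lt hx0 (show 0 < Φ.depth by simp [SyndromeCircuit.depth]) hn
    refine (hfin.diamondNorm_le ?_).trans_lt ?_
    · exact sub_nonneg.2 (one_le_pow₀ (by linarith))
    · refine (ENNReal.ofReal_lt_ofReal_iff ?_).2 hlt
      have : (0 : ℝ) < Φ.depth := by simp [SyndromeCircuit.depth]; positivity
      positivity
  -- The total weight `10μ + 10μ(3·2^m - 2)` is at most `40μ·2^m`, which is the claimed bound at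
  -- depth `m + 2`.
  · refine superoperatorsOfWeight_mono ?_ (comp_mem_superoperatorsOfWeight hM hN)
    have hp : (0 : ℝ) < 2 ^ Φ.numEntangling := by positivity
    have e : 5 * n * δ * 2 ^ (Φ.depth + 1) = 40 * μ * 2 ^ Φ.numEntangling := by
      rw [SyndromeCircuit.depth, hμ]; ring
    rw [e]
    nlinarith [mul_nonneg hμ0 hp.le]
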